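/- Let $K$ be a field of characteristic zero. An integro-differential algebra over $K$ is a commutative unital $K$-algebra with a $K$-linear derivation $\partial$ (written $f'=\partial f$) and a $K$-linear map $\int$ such that $\partial\int f=f$ and $(\int f')(\int g')+\int (fg)'=(\int f')g+f\int g'$; its evaluation is $\mathbf e=1-\int\circ\,\partial$. Let $(\mathcal F,\partial,\int_{\mathcal F})$ be such an algebra which is ordinary, i.e. $\dim_K\ker\partial=1$, and write $f(0)=\mathbf e f$ for $f\in\mathcal F$. Let $\mathcal F\{u\}$ be the algebra of integro-differential polynomials: the set of all terms built from coefficients in $\mathcal F$ and one indeterminate $u$ with the ring operations, the scalar multiplications by elements of $K$, and $\partial,\int,\mathbf e$, modulo equality derivable from the identities of integro-differential algebras over $K$ and the operations of $\mathcal F$. For finitely supported multi-indices $\alpha,\beta:\mathbb N\to\mathbb N$ put $u_i=\partial^i u$, $u^\beta=\prod_i u_i^{\beta_i}$ and $u(0)^\alpha=\prod_i(\mathbf e\,u_i)^{\alpha_i}$. Call $u^\beta$ quasiconstant if $\beta=0$; quasilinear if its highest derivative is some $u_{k+1}$ with $k\ge 0$ and appears to the first power; functional otherwise (so $u=u_0$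 is functional). A reduced term is $f\,u(0)^\alpha u^\beta J$ with $f\in\mathcal F$ and $J=\int f_1u^{\gamma_1}\int\cdots\int f_nu^{\gamma_n}$, where $n\ge 0$ ($J=1$ for $n=0$), $f_i\in\mathcal F$ and all $u^{\gamma_i}$ are functional. Let $[R]$ be the $K$-vector space freely generated by the reduced terms, modulo the subspace generated by the relations expressing $K$-linearity in $f$ and in each $f_i$, and write $[\,\cdot\,]$ for classes. For $J=\int f_1u^{\gamma_1}J_1$ put $J'=f_1u^{\gamma_1}J_1$, and $1'=0$; put $\kappa(J)=1$ if $J=1$ and $\kappa(J)=0$ otherwise. **Theorem.** (1) There are a unique $K$-bilinear multiplication, unique $K$-linear operators $\partial,\int$ on $[R]$ and a unique distinguished element $1=[1]$ such that, for all generators, * $[f u(0)^\alpha u^\beta J]\,[\tilde f u(0)^{\tilde\alpha}u^{\tilde\beta}\tilde J]=\sum_L [f\tilde f\,u(0)^{\alpha+\tilde\alpha}u^{\beta+\tilde\beta}L]$, where $L$ runs over all shuffles (with repetitions) of $J$ and $\tilde J$, regarded as words in the letters $\int f_iu^{\gamma_i}$; * $\partial[f u(0)^\alpha u^\beta J]=[f'u(0)^\alpha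 u^\beta J]+\sum_{i:\,\beta_i\neq 0}\beta_i\,[f u(0)^\alpha u^{\beta}u_i^{-1}u_{i+1}J]+[f u(0)^\alpha u^\beta J']$; * (quasiconstant) $\int[f u(0)^\alpha J]=[u(0)^\alpha(\int_{\mathcal F}f)J]-[u(0)^\alpha\int(\int_{\mathcal F}f)J']$; * (quasilinear) for $k\ge 0$, $s\ge 1$ and a monomial $V$ in $u_0,\dots,u_{k-1}$, with $(u_k^s)'=s\,u_k^{s-1}u_{k+1}$ and $u^\delta=Vu_k^s$, $$\int[f u(0)^\alpha V(u_k^s)'J]=[f u(0)^\alpha Vu_k^sJ]-[u(0)^\alpha]\int\bigl(\partial[fVJ]\cdot[u_k^s]\bigr)-[f(0)\,u(0)^{\alpha+\delta}\kappa(J)];$$ * (functional) $\int[f u(0)^\alpha u^\beta J]=[u(0)^\alpha\int f u^\beta J]$ if $u^\beta$ is functional. (2) With these operations $[R]$ is an integro-differential algebra over $K$. Sending the class of each reduced term to the integro-differential polynomial which that term represents defines an isomorphism $[R]\cong\mathcal F\{u\}$ of integro-differential algebras. (3) For every $K$-basis $\mathcal B$ of $\mathcal F$ (in particular for one that contains $1$),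 the $K$-linear combinations of the reduced terms $b\,u(0)^\alpha u^\beta\int b_1u^{\gamma_1}\cdots\int b_nu^{\gamma_n}$ with $b,b_1,\dots,b_n\in\mathcal B$ and all $u^{\gamma_i}$ functional are canonical forms for $\mathcal F\{u\}$: every element of $\mathcal F\{u\}$ is represented by exactly one such linear combination. -/

import Mathlib

namespace IntDiff

universe u v w

/-! ### Integro-differential algebras -/

/-- An integro-differential algebra over `K`: a commutative differential `K`-algebra together with
a `K`-linear section of the derivation satisfying the differential Baxter identity. -/
class IntegroDifferentialAlgebra (K : Type u) (A : Type v) [CommRing K] [CommRing A]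
    [Algebra K A] where
  derivation : Derivation K A A
  integral : A →ₗ[K] A
  der_of_integ : ∀ f, derivation (integral f) = f
  baxter : ∀ f g, integral (derivation f) * integral (derivation g)
    + integral (derivation (f * g)) = integral (derivation f) * g + f * integral (derivation g)

section Algebra

variable (K : Type u) {A : Type v} [CommRing K] [CommRing A] [Algebra K A]
  [IntegroDifferentialAlgebra K A]

/-- The derivation of an integro-differential algebra. -/
def der : A →ₗ[K] A := (IntegroDifferentialAlgebra.derivation (K := K) (A := A)).toLinearMap

/-- The integral of an integro-differential algebra. -/
def integ : A →ₗ[K] A := IntegroDifferentialAlgebra.integral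

/-- The evaluation `1 - ∫ ∘ ∂` of an integro-differential algebra. -/
def evaluation : A →ₗ[K] A := LinearMap.id - integ K ∘ₗ der K

end Algebra

/-- A differential algebra is ordinary if its space of constants is one-dimensional. -/
def IsOrdinary (K : Type u) (A : Type v) [Field K] [CommRing A] [Algebra K A]
    [IntegroDifferentialAlgebra K A] : Prop :=
  Module.finrank K (LinearMap.ker (der K : A →ₗ[K] A)) = 1

/-! ### Integro-differential polynomials as classes of terms -/

/-- Terms in the signature of integro-differential algebras over `K`, with coefficients in `F` and
one indeterminate. -/
inductive Term (K : Type u) (F : Type v) : Type (max u v)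
  | coeff (f : F)
  | indet
  | zero
  | one
  | add (s t : Term K F)
  | neg (t : Term K F)
  | mul (s t : Term K F)
  | smul (c : K) (t : Term K F)
  | der (t : Term K F)
  | integ (t : Term K F)
  | eval (t : Term K F)

/-- The congruence on terms: equality derivable in finitely many steps from the identities of
integro-differential algebras and from the operations of the coefficient algebra. -/
inductive Term.Rel (K : Type u) (F : Type v) [CommRing K] [CommRing F] [Algebra K F]
    [IntegroDifferentialAlgebra K F] : Term K F → Term K F → Prop
  | refl (t) : Rel K F t t
  | symm {s t} : Rel K F s t → Rel K F t s
  | trans {r s t} : Rel K F r s → Rel K F s t → Rel K F r t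
  -- compatibility with the operations
  | add_congr {s s' t t'} : Rel K F s s' → Rel K F t t' → Rel K F (.add s t) (.add s' t')
  | neg_congr {t t'} : Rel K F t t' → Rel K F (.neg t) (.neg t')
  | mul_congr {s s' t t'} : Rel K F s s' → Rel K F t t' → Rel K F (.mul s t) (.mul s' t')
  | smul_congr (c : K) {t t'} : Rel K F t t' → Rel K F (.smul c t) (.smul c t')
  | der_congr {t t'} : Rel K F t t' → Rel K F (.der t) (.der t')
  | integ_congr {t t'} : Rel K F t t' → Rel K F (.integ t) (.integ t')
  | eval_congr {t t'} : Rel K F t t' → Rel K F (.eval t) (.eval t')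
  -- commutative `K`-algebras
  | add_assoc (r s t) : Rel K F (.add (.add r s) t) (.add r (.add s t))
  | add_comm (s t) : Rel K F (.add s t) (.add t s)
  | zero_add (t) : Rel K F (.add .zero t) t
  | neg_add (t) : Rel K F (.add (.neg t) t) .zero
  | mul_assoc (r s t) : Rel K F (.mul (.mul r s) t) (.mul r (.mul s t))
  | mul_comm (s t) : Rel K F (.mul s t) (.mul t s)
  | one_mul (t) : Rel K F (.mul .one t) t
  | mul_add (r s t) : Rel K F (.mul r (.add s t)) (.add (.mul r s) (.mul r t))
  | smul_add (c : K) (s t) : Rel K F (.smul c (.add s t)) (.add (.smul c s) (.smul c t))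
  | add_smul (c d : K) (t) : Rel K F (.smul (c + d) t) (.add (.smul c t) (.smul d t))
  | mul_smul (c d : K) (t) : Rel K F (.smul (c * d) t) (.smul c (.smul d t))
  | one_smul (t) : Rel K F (.smul 1 t) t
  | smul_mul (c : K) (s t) : Rel K F (.mul (.smul c s) t) (.smul c (.mul s t))
  -- linearity of the three operators
  | der_add (s t) : Rel K F (.der (.add s t)) (.add (.der s) (.der t))
  | der_smul (c : K) (t) : Rel K F (.der (.smul c t)) (.smul c (.der t))
  | integ_add (s t) : Rel K F (.integ (.add s t)) (.add (.integ s) (.integ t))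
  | integ_smul (c : K) (t) : Rel K F (.integ (.smul c t)) (.smul c (.integ t))
  | eval_add (s t) : Rel K F (.eval (.add s t)) (.add (.eval s) (.eval t))
  | eval_smul (c : K) (t) : Rel K F (.eval (.smul c t)) (.smul c (.eval t))
  -- Leibniz rule, section identity, definition of the evaluation, integration by parts
  | leibniz (s t) : Rel K F (.der (.mul s t)) (.add (.mul (.der s) t) (.mul s (.der t)))
  | der_of_integ (t) : Rel K F (.der (.integ t)) t
  | eval_def (t) : Rel K F (.eval t) (.add t (.neg (.integ (.der t))))
  | by_parts (s t) : Rel K F (.mul s (.integ t))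
      (.add (.integ (.mul s t)) (.integ (.mul (.der s) (.integ t))))
  -- operations of the coefficient algebra
  | coeff_zero : Rel K F (.coeff 0) .zero
  | coeff_one : Rel K F (.coeff 1) .one
  | coeff_add (f g : F) : Rel K F (.coeff (f + g)) (.add (.coeff f) (.coeff g))
  | coeff_neg (f : F) : Rel K F (.coeff (-f)) (.neg (.coeff f))
  | coeff_mul (f g : F) : Rel K F (.coeff (f * g)) (.mul (.coeff f) (.coeff g))
  | coeff_smul (c : K) (f : F) : Rel K F (.coeff (c • f)) (.smul c (.coeff f))
  | coeff_der (f : F) : Rel K F (.coeff (IntDiff.der K f)) (.der (.coeff f))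
  | coeff_integ (f : F) : Rel K F (.coeff (IntDiff.integ K f)) (.integ (.coeff f))
  | coeff_eval (f : F) : Rel K F (.coeff (IntDiff.evaluation K f)) (.eval (.coeff f))

section Poly

variable (K : Type u) (F : Type v) [CommRing K] [CommRing F] [Algebra K F]
  [IntegroDifferentialAlgebra K F]

/-- The congruence as a setoid. -/
def Term.setoid : Setoid (Term K F) :=
  ⟨Term.Rel K F, Term.Rel.refl, Term.Rel.symm, Term.Rel.trans⟩

/-- The algebra `F{u}` of integro-differential polynomials in one indeterminate `u` over `F`. -/
def Poly : Type (max u v) := Quotient (Term.setoid K F)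

namespace Poly

variable {K F}

/-- The polynomial represented by a term. -/
def mk (t : Term K F) : Poly K F := Quotient.mk (Term.setoid K F) t

theorem sound {s t : Term K F} (h : Term.Rel K F s t) : mk s = mk t := Quotient.sound h

instance : Zero (Poly K F) := ⟨mk .zero⟩
instance : One (Poly K F) := ⟨mk .one⟩
instance : Add (Poly K F) := ⟨Quotient.map₂ Term.add fun _ _ h _ _ h' => .add_congr h h'⟩
instance : Neg (Poly K F) := ⟨Quotient.map Term.neg fun _ _ h => .neg_congr h⟩
instance : Mul (Poly K F) := ⟨Quotient.map₂ Term.mul fun _ _ h _ _ h' => .mul_congr h h'⟩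
instance : SMul K (Poly K F) := ⟨fun c => Quotient.map (Term.smul c) fun _ _ h => .smul_congr c h⟩

/-- The operation on polynomials induced by the derivation symbol. -/
def der' : Poly K F → Poly K F := Quotient.map Term.der fun _ _ h => .der_congr h

/-- The operation on polynomials induced by the integral symbol. -/
def integ' : Poly K F → Poly K F := Quotient.map Term.integ fun _ _ h => .integ_congr h

theorem add_comm' (a b : Poly K F) : a + b = b + a := by
  induction a using Quotient.inductionOn
  induction b using Quotient.inductionOn
  exact sound (.add_comm _ _)

theorem mul_comm' (a b : Poly K F) : a * b = b * a := by
  induction a using Quotient.inductionOn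
  induction b using Quotient.inductionOn
  exact sound (.mul_comm _ _)

theorem zero_add' (a : Poly K F) : 0 + a = a := by
  induction a using Quotient.inductionOn
  exact sound (.zero_add _)

theorem one_mul' (a : Poly K F) : 1 * a = a := by
  induction a using Quotient.inductionOn
  exact sound (.one_mul _)

theorem add_assoc' (a b c : Poly K F) : a + b + c = a + (b + c) := by
  induction a using Quotient.inductionOn
  induction b using Quotient.inductionOn
  induction c using Quotient.inductionOn
  exact sound (.add_assoc _ _ _)

theorem mul_assoc' (a b c : Poly K F) : a * b * c = a * (b * c) := by
  induction a using Quotient.inductionOn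
  induction b using Quotient.inductionOn
  induction c using Quotient.inductionOn
  exact sound (.mul_assoc _ _ _)

theorem mul_add' (a b c : Poly K F) : a * (b + c) = a * b + a * c := by
  induction a using Quotient.inductionOn
  induction b using Quotient.inductionOn
  induction c using Quotient.inductionOn
  exact sound (.mul_add _ _ _)

theorem neg_add' (a : Poly K F) : -a + a = 0 := by
  induction a using Quotient.inductionOn
  exact sound (.neg_add _)

instance : AddCommGroup (Poly K F) where
  add_assoc := add_assoc'
  zero_add := zero_add'
  add_zero a := by rw [add_comm', zero_add']
  add_comm := add_comm'
  neg_add_cancel := neg_add'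
  nsmul := nsmulRec
  zsmul := zsmulRec

instance : CommRing (Poly K F) where
  __ := (inferInstance : AddCommGroup (Poly K F))
  mul_assoc := mul_assoc'
  one_mul := one_mul'
  mul_one a := by rw [mul_comm', one_mul']
  mul_comm := mul_comm'
  left_distrib := mul_add'
  right_distrib a b c := by rw [mul_comm', mul_add', mul_comm' c a, mul_comm' c b]
  zero_mul a := by
    have h : a * 0 + a * 0 = a * 0 := by rw [← mul_add', zero_add']
    rw [mul_comm']
    exact left_eq_add.mp h.symm
  mul_zero a := by
    have h : a * 0 + a * 0 = a * 0 := by rw [← mul_add', zero_add']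
    exact left_eq_add.mp h.symm

theorem smul_add' (c : K) (a b : Poly K F) : c • (a + b) = c • a + c • b := by
  induction a using Quotient.inductionOn
  induction b using Quotient.inductionOn
  exact sound (.smul_add _ _ _)

theorem add_smul' (c d : K) (a : Poly K F) : (c + d) • a = c • a + d • a := by
  induction a using Quotient.inductionOn
  exact sound (.add_smul _ _ _)

theorem smul_mul' (c : K) (a b : Poly K F) : c • a * b = c • (a * b) := by
  induction a using Quotient.inductionOn
  induction b using Quotient.inductionOn
  exact sound (.smul_mul _ _ _)

instance : Module K (Poly K F) where
  one_smul a := by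
    induction a using Quotient.inductionOn
    exact sound (.one_smul _)
  mul_smul c d a := by
    induction a using Quotient.inductionOn
    exact sound (.mul_smul _ _ _)
  smul_zero c := by
    have h := smul_add' c (0 : Poly K F) 0
    rw [zero_add'] at h
    exact left_eq_add.mp h
  smul_add := smul_add'
  add_smul := add_smul'
  zero_smul a := by
    have h := add_smul' (0 : K) 0 a
    rw [zero_add] at h
    exact left_eq_add.mp h

instance : Algebra K (Poly K F) :=
  Algebra.ofModule smul_mul' fun c a b => by rw [mul_comm', smul_mul', mul_comm']

/-- The derivation as a linear map. -/
def derLin : Poly K F →ₗ[K] Poly K F where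
  toFun := der'
  map_add' a b := by
    induction a using Quotient.inductionOn
    induction b using Quotient.inductionOn
    exact sound (.der_add _ _)
  map_smul' c a := by
    induction a using Quotient.inductionOn
    exact sound (.der_smul _ _)

theorem derLin_mul (a b : Poly K F) : derLin (a * b) = derLin a * b + a * derLin b := by
  induction a using Quotient.inductionOn
  induction b using Quotient.inductionOn
  exact sound (.leibniz _ _)

/-- The integral as a linear map. -/
def integLin : Poly K F →ₗ[K] Poly K F where
  toFun := integ'
  map_add' a b := by
    induction a using Quotient.inductionOn
    induction b using Quotient.inductionOn
    exact sound (.integ_add _ _)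
  map_smul' c a := by
    induction a using Quotient.inductionOn
    exact sound (.integ_smul _ _)

theorem derLin_integLin (a : Poly K F) : derLin (integLin a) = a := by
  induction a using Quotient.inductionOn
  exact sound (.der_of_integ _)

theorem by_parts (a b : Poly K F) :
    a * integLin b = integLin (a * b) + integLin (derLin a * integLin b) := by
  induction a using Quotient.inductionOn
  induction b using Quotient.inductionOn
  exact sound (.by_parts _ _)

/-- The algebra of integro-differential polynomials is an integro-differential algebra, with the
operations induced by those on terms. -/
instance : IntegroDifferentialAlgebra K (Poly K F) where
  derivation := Derivation.mk' derLin fun a b => by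
    rw [derLin_mul, smul_eq_mul, smul_eq_mul]; ring
  integral := integLin
  der_of_integ := derLin_integLin
  baxter f g := by
    change integLin (derLin f) * integLin (derLin g) + integLin (derLin (f * g))
      = integLin (derLin f) * g + f * integLin (derLin g)
    have h1 := by_parts f (derLin g)
    have h2 := by_parts g (derLin f)
    have h3 := by_parts (integLin (derLin f)) (derLin g)
    rw [derLin_integLin] at h3
    rw [mul_comm (derLin g) (integLin (derLin f)), mul_comm g (derLin f)] at h2
    rw [derLin_mul, map_add]
    linear_combination h3 - h1 - h2

/-- Coefficients as integro-differential polynomials. -/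
def coeff (f : F) : Poly K F := mk (.coeff f)

/-- The indeterminate. -/
def indet : Poly K F := mk .indet

end Poly

end Poly

/-! ### Reduced terms -/

/-- Multi-indices: finitely supported sequences of natural numbers. -/
abbrev MultiIndex : Type := ℕ →₀ ℕ

/-- The differential monomial `u ^ β` is quasilinear: its highest derivative is some proper
derivative `u_{k+1}`, and that derivative appears linearly. -/
def MultiIndex.IsQuasilinear (β : MultiIndex) : Prop :=
  ∃ k, β (k + 1) = 1 ∧ ∀ j, k + 1 < j → β j = 0

/-- The differential monomial `u ^ β` is functional: it is neither quasiconstant (`β = 0`) nor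
quasilinear. -/
def MultiIndex.IsFunctional (β : MultiIndex) : Prop := β ≠ 0 ∧ ¬ β.IsQuasilinear

/-- Letters of nested integrals: pairs `(f, γ)` standing for `∫ f u ^ γ`, with `u ^ γ`
functional. -/
abbrev Letter (C : Type w) : Type w := C × {γ : MultiIndex // γ.IsFunctional}

/-- The term `f u(0)^α u^β ∫ f₁ u^γ₁ ⋯ ∫ fₙ u^γₙ` with functional inner monomials and with
`f, f₁, …, fₙ` in `C`. -/
structure RedTerm (C : Type w) : Type w where
  coeff : C
  init : MultiIndex
  mon : MultiIndex
  nest : List (Letter C)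

/-- Apply a map to all coefficients of a reduced term. -/
def RedTerm.map {C : Type v} {D : Type w} (h : C → D) (t : RedTerm C) : RedTerm D :=
  ⟨h t.coeff, t.init, t.mon, t.nest.map fun p => (h p.1, p.2)⟩

/-- The list of all shuffles (with repetitions) of two words. -/
def shuffles {L : Type w} : List L → List L → List (List L)
  | [], ys => [ys]
  | x :: xs, [] => [x :: xs]
  | x :: xs, y :: ys =>
    (shuffles xs (y :: ys)).map (List.cons x) ++ (shuffles (x :: xs) ys).map (List.cons y)
termination_by xs ys => xs.length + ys.length

section Represent

variable {K : Type u} {F : Type v} [CommRing K] [CommRing F] [Algebra K F]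
  [IntegroDifferentialAlgebra K F]

/-- The `i`-th derivative `u_i` of the indeterminate. -/
noncomputable def Poly.uder (i : ℕ) : Poly K F := (der K)^[i] Poly.indet

/-- The differential monomial `u ^ β`. -/
noncomputable def Poly.diffMon (β : MultiIndex) : Poly K F := β.prod fun i n => Poly.uder i ^ n

/-- The monomial `u(0) ^ α` in the initial values. -/
noncomputable def Poly.initMon (α : MultiIndex) : Poly K F :=
  α.prod fun i n => evaluation K (Poly.uder i : Poly K F) ^ n

/-- The nested integral `∫ f₁ u^γ₁ ∫ ⋯ ∫ fₙ u^γₙ`, which is `1` for `n = 0`. -/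
noncomputable def Poly.nested : List (Letter F) → Poly K F
  | [] => 1
  | (f, γ) :: J => integ K (Poly.coeff f * Poly.diffMon γ.1 * Poly.nested J)

/-- The integro-differential polynomial represented by a reduced term. -/
noncomputable def Poly.ofRedTerm (t : RedTerm F) : Poly K F :=
  Poly.coeff t.coeff * Poly.initMon t.init * Poly.diffMon t.mon * Poly.nested t.nest

end Represent

/-! ### The quotient space of reduced terms -/

section Quotient

variable (K : Type u) (F : Type v) [CommRing K] [CommRing F] [Algebra K F]

open Finsupp in
/-- The linearity relations in the free module generated by the reduced terms. -/
inductive LinearityRelation : (RedTerm F →₀ K) → Prop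
  | coeff_add (f g : F) (α β : MultiIndex) (J : List (Letter F)) :
      LinearityRelation (single ⟨f + g, α, β, J⟩ 1 - (single ⟨f, α, β, J⟩ 1 + single ⟨g, α, β, J⟩ 1))
  | coeff_smul (c : K) (f : F) (α β : MultiIndex) (J : List (Letter F)) :
      LinearityRelation (single ⟨c • f, α, β, J⟩ 1 - c • single ⟨f, α, β, J⟩ 1)
  | nest_add (f : F) (α β : MultiIndex) (J : List (Letter F)) (g h : F)
      (γ : {γ : MultiIndex // γ.IsFunctional}) (J' : List (Letter F)) :
      LinearityRelation (single ⟨f, α, β, J ++ (g + h, γ) :: J'⟩ 1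
        - (single ⟨f, α, β, J ++ (g, γ) :: J'⟩ 1 + single ⟨f, α, β, J ++ (h, γ) :: J'⟩ 1))
  | nest_smul (f : F) (α β : MultiIndex) (J : List (Letter F)) (c : K) (g : F)
      (γ : {γ : MultiIndex // γ.IsFunctional}) (J' : List (Letter F)) :
      LinearityRelation (single ⟨f, α, β, J ++ (c • g, γ) :: J'⟩ 1
        - c • single ⟨f, α, β, J ++ (g, γ) :: J'⟩ 1)

/-- The quotient space `[R]`: the free `K`-module on the reduced terms, modulo the subspace
generated by the linearity relations. -/
abbrev RedSpace : Type (max u v) :=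
  (RedTerm F →₀ K) ⧸ Submodule.span K {x : RedTerm F →₀ K | LinearityRelation K F x}

variable {F}

/-- The class `[f u(0)^α u^β J]` in the quotient space. -/
noncomputable def cls (f : F) (α β : MultiIndex) (J : List (Letter F)) : RedSpace K F :=
  Submodule.Quotient.mk (Finsupp.single ⟨f, α, β, J⟩ 1)

/-- The class `[f u(0)^α u^β J']`, where `J'` is the derivative of the integral term `J`: it is zero
for `J = 1`, and `g u^γ J₁` for `J = ∫ g u^γ J₁`. -/
noncomputable def clsMulDerNest (f : F) (α β : MultiIndex) : List (Letter F) → RedSpace K F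
  | [] => 0
  | (g, γ) :: J => cls K (f * g) α (β + γ.1) J

/-- The class `[u(0)^α ∫ f J']` for an integral term `J` with derivative `J'`. -/
noncomputable def clsIntMulDerNest (f : F) (α : MultiIndex) : List (Letter F) → RedSpace K F
  | [] => 0
  | (g, γ) :: J => cls K 1 α 0 ((f * g, γ) :: J)

/-- The class `[f u(0)^α κ(J)]`, where `κ(J)` is `1` for `J = 1` and zero otherwise. -/
noncomputable def clsEval (f : F) (α : MultiIndex) : List (Letter F) → RedSpace K F
  | [] => cls K f α 0 []
  | _ :: _ => 0

end Quotient

/-! ### Operations on the quotient space -/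

/-- Operations on a `K`-module `A`: a bilinear multiplication with a distinguished element, and two
linear operators. -/
@[ext]
structure Operations (K : Type u) (A : Type v) [CommRing K] [AddCommGroup A] [Module K A] where
  one : A
  mul : A →ₗ[K] A →ₗ[K] A
  der : A →ₗ[K] A
  integ : A →ₗ[K] A

/-- The operations turn the `K`-module `A` into an integro-differential algebra over `K`. -/
structure Operations.IsIntegroDifferential {K : Type u} {A : Type v} [CommRing K] [AddCommGroup A]
    [Module K A] (S : Operations K A) : Prop where
  mul_assoc : ∀ a b c, S.mul (S.mul a b) c = S.mul a (S.mul b c)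
  mul_comm : ∀ a b, S.mul a b = S.mul b a
  one_mul : ∀ a, S.mul S.one a = a
  leibniz : ∀ a b, S.der (S.mul a b) = S.mul (S.der a) b + S.mul a (S.der b)
  der_of_integ : ∀ a, S.der (S.integ a) = a
  baxter : ∀ a b, S.mul (S.integ (S.der a)) (S.integ (S.der b)) + S.integ (S.der (S.mul a b))
    = S.mul (S.integ (S.der a)) b + S.mul a (S.integ (S.der b))

/-- The defining equations, on generators, of the operations on the quotient space of reduced
terms. -/
structure IsReducedOperations {K : Type u} {F : Type v} [Field K] [CommRing F] [Algebra K F]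
    [IntegroDifferentialAlgebra K F] (S : Operations K (RedSpace K F)) : Prop where
  one_eq : S.one = cls K 1 0 0 []
  /-- Multiplication by means of the shuffle product of integral terms. -/
  mul_eq : ∀ (f g : F) (α α' β β' : MultiIndex) (J J' : List (Letter F)),
    S.mul (cls K f α β J) (cls K g α' β' J')
      = ((shuffles J J').map fun L => cls K (f * g) (α + α') (β + β') L).sum
  /-- The derivation: Leibniz rule on `f`, on `u^β` (with `u_i' = u_{i+1}`), and on `J`. -/
  der_eq : ∀ (f : F) (α β : MultiIndex) (J : List (Letter F)),
    S.der (cls K f α β J) = cls K (der K f) α β J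
      + (β.sum fun i n =>
          (n : K) • cls K f α (β - Finsupp.single i 1 + Finsupp.single (i + 1) 1) J)
      + clsMulDerNest K f α β J
  /-- The integral, quasiconstant case. -/
  integ_quasiconstant : ∀ (f : F) (α : MultiIndex) (J : List (Letter F)),
    S.integ (cls K f α 0 J) = cls K (integ K f) α 0 J - clsIntMulDerNest K (integ K f) α J
  /-- The integral, quasilinear case: `f u(0)^α V (u_k^{b+1})' J`, where `V` is a monomial in
  `u_0, …, u_{k-1}` and where `(u_k^{b+1})' = (b+1) u_k^b u_{k+1}`. -/
  integ_quasilinear : ∀ (f : F) (α V : MultiIndex) (k b : ℕ) (J : List (Letter F)),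
    (∀ j, k ≤ j → V j = 0) →
    S.integ (((b + 1 : ℕ) : K) •
        cls K f α (V + Finsupp.single k b + Finsupp.single (k + 1) 1) J)
      = cls K f α (V + Finsupp.single k (b + 1)) J
        - S.mul (cls K 1 α 0 [])
            (S.integ (S.mul (S.der (cls K f 0 V J)) (cls K 1 0 (Finsupp.single k (b + 1)) [])))
        - clsEval K (evaluation K f) (α + (V + Finsupp.single k (b + 1))) J
  /-- The integral, functional case. -/
  integ_functional : ∀ (f : F) (α : MultiIndex) (β : {β : MultiIndex // β.IsFunctional})
      (J : List (Letter F)),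
    S.integ (cls K f α β.1 J) = cls K 1 α 0 ((f, β) :: J)

end IntDiff

open IntDiff

/-!
Let `𝐞` be the linear map on `[R]` that sends `f u(0)^α u^β J` to `f(0) u(0)^(α + β)` if `J = 1`
and to zero otherwise (`redEval`). It is multiplicative for the shuffle product, and its values are
constants. The defining equations of the integral say no more and no less than
`∫ ∘ ∂ = 1 - 𝐞` (`IsReducedOperations.integ_redDer`): the quasilinear equation is this identity on
`f u(0)^α V u_k^s J`, and the quasiconstant and functional equations together give it on
`f u(0)^α J`, where `f(0)` is a scalar because the coefficient algebra is ordinary.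

Existence. The integral of `f u^β J` is defined by recursion on `J` and on the order of `u^β`, as a
linear map in `f` (`integMon`, `integNest`). It is linear in the coefficients of `J` as well
(`nestLinear_integNest`), so it descends to the quotient, and `∂ ∘ ∫ = 1` follows by the same
recursion (`redDer_redInteg`). A derivation `∂` with `∂ ∘ ∫ = 1` and `∫ ∘ ∂ = 1 - 𝐞` for a
multiplicative `𝐞` satisfies the differential Baxter identity (`redBaxter`).

Uniqueness. Multiplication and derivation are given on generators. As `∂` is surjective,
`∫ ∘ ∂ = 1 - 𝐞` determines `∫`.

Isomorphism. The map from `[R]` to `F{u}` (`represent`) respects products by the Rota--Baxter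
identity, and derivatives and evaluations by direct calculation. Then it respects integrals, since
`∫ g` is the only antiderivative of `g` whose evaluation vanishes (`eq_of_der_of_evaluation`). In the
other direction, `F{u}` maps to every integro-differential algebra under `F`, in particular to
`[R]` (`exists_reduction`). Both composites fix the generators, so the two maps are mutually
inverse.

Canonical forms. Expanding the coefficients in a basis of `F` shows that the reduced terms with
basis coefficients form a basis of `[R]` (`bijective_linearCombination_termCls`).
-/

namespace IntDiff

universe u v w w'

/-! ### Linear maps on the space of reduced terms -/

section Linear

variable {K : Type u} {F : Type v} [CommRing K] [CommRing F] [Algebra K F]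
  {M : Type w} [AddCommGroup M] [Module K M] {N : Type w'} [AddCommGroup N] [Module K N]

theorem isLinearMap_add {φ ψ : F → M} (hφ : IsLinearMap K φ) (hψ : IsLinearMap K ψ) :
    IsLinearMap K fun g => φ g + ψ g :=
  (hφ.mk' φ + hψ.mk' ψ).isLinear

theorem isLinearMap_sub {φ ψ : F → M} (hφ : IsLinearMap K φ) (hψ : IsLinearMap K ψ) :
    IsLinearMap K fun g => φ g - ψ g :=
  (hφ.mk' φ - hψ.mk' ψ).isLinear

theorem isLinearMap_zero : IsLinearMap K fun _ : F => (0 : M) :=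
  (0 : F →ₗ[K] M).isLinear

theorem isLinearMap_apply {φ : F → M} (T : M →ₗ[K] N) (hφ : IsLinearMap K φ) :
    IsLinearMap K fun g => T (φ g) :=
  (T ∘ₗ hφ.mk' φ).isLinear

theorem isLinearMap_comp {φ : F → M} (hφ : IsLinearMap K φ) (T : F →ₗ[K] F) :
    IsLinearMap K fun g => φ (T g) :=
  (hφ.mk' φ ∘ₗ T).isLinear

theorem isLinearMap_smul {φ : F → M} (c : K) (hφ : IsLinearMap K φ) :
    IsLinearMap K fun g => c • φ g :=
  (c • hφ.mk' φ).isLinear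

theorem isLinearMap_list_sum {X : Type*} (l : List X) {φ : X → F → M}
    (hφ : ∀ i, IsLinearMap K (φ i)) : IsLinearMap K fun g => (l.map fun i => φ i g).sum := by
  induction l with
  | nil => simpa using isLinearMap_zero
  | cons x l ih => simpa using isLinearMap_add (hφ x) ih

variable (K) in
/-- A function of nested integrals is nest-linear if it is `K`-linear in the coefficient of each
letter, the rest of the word being fixed. -/
def NestLinear (Φ : List (Letter F) → M) : Prop :=
  ∀ P γ Q, IsLinearMap K fun g => Φ (P ++ (g, γ) :: Q)

namespace NestLinear

theorem head {Φ : List (Letter F) → M} (h : NestLinear K Φ) (γ Q) :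
    IsLinearMap K fun g => Φ ((g, γ) :: Q) := h [] γ Q

theorem tail {Φ : List (Letter F) → M} (h : NestLinear K Φ) (x : Letter F) :
    NestLinear K fun J => Φ (x :: J) := fun P γ Q => h (x :: P) γ Q

theorem of_cons {Φ : List (Letter F) → M}
    (h : ∀ γ Q, IsLinearMap K fun g => Φ ((g, γ) :: Q))
    (h' : ∀ x, NestLinear K fun J => Φ (x :: J)) : NestLinear K Φ
  | [], γ, Q => h γ Q
  | x :: P, γ, Q => h' x P γ Q

theorem add {Φ Ψ : List (Letter F) → M} (h : NestLinear K Φ) (h' : NestLinear K Ψ) :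
    NestLinear K fun J => Φ J + Ψ J := fun P γ Q => isLinearMap_add (h P γ Q) (h' P γ Q)

theorem apply {Φ : List (Letter F) → M} (T : M →ₗ[K] N) (h : NestLinear K Φ) :
    NestLinear K fun J => T (Φ J) := fun P γ Q => isLinearMap_apply T (h P γ Q)

end NestLinear

theorem isLinearMap_cls (α β : MultiIndex) (J : List (Letter F)) :
    IsLinearMap K fun f => cls K f α β J where
  map_add f g := by
    refine (Submodule.Quotient.eq _).2 (Submodule.subset_span ?_)
    exact .coeff_add f g α β J
  map_smul c f := by
    refine (Submodule.Quotient.eq _).2 (Submodule.subset_span ?_)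
    exact .coeff_smul c f α β J

theorem nestLinear_cls (f : F) (α β : MultiIndex) : NestLinear K (cls K f α β) := fun P γ Q =>
  { map_add := fun g h => by
      refine (Submodule.Quotient.eq _).2 (Submodule.subset_span ?_)
      exact .nest_add f α β P g h γ Q
    map_smul := fun c g => by
      refine (Submodule.Quotient.eq _).2 (Submodule.subset_span ?_)
      exact .nest_smul f α β P c g γ Q }

/-- The linear map on the space of reduced terms with prescribed values on the generators. -/
noncomputable def liftRed (Φ : F → MultiIndex → MultiIndex → List (Letter F) → M)
    (hf : ∀ α β J, IsLinearMap K fun f => Φ f α β J) (hJ : ∀ f α β, NestLinear K (Φ f α β)) :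
    RedSpace K F →ₗ[K] M :=
  Submodule.liftQ _
    (Finsupp.linearCombination K fun t : RedTerm F => Φ t.coeff t.init t.mon t.nest) <| by
    rw [Submodule.span_le]
    rintro _ (⟨f, g, α, β, J⟩ | ⟨c, f, α, β, J⟩ | ⟨f, α, β, J, g, h, γ, J'⟩ |
      ⟨f, α, β, J, c, g, γ, J'⟩)
    · simpa [sub_eq_zero] using (hf α β J).map_add f g
    · simpa [sub_eq_zero] using (hf α β J).map_smul c f
    · simpa [sub_eq_zero] using (hJ f α β J γ J').map_add g h
    · simpa [sub_eq_zero] using (hJ f α β J γ J').map_smul c g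

@[simp]
theorem liftRed_cls (Φ : F → MultiIndex → MultiIndex → List (Letter F) → M) (hf hJ)
    (f : F) (α β : MultiIndex) (J : List (Letter F)) :
    liftRed (K := K) Φ hf hJ (cls K f α β J) = Φ f α β J :=
  (Submodule.liftQ_apply _ _ _).trans (by simp)

@[elab_as_elim]
theorem redSpace_induction {p : RedSpace K F → Prop} (x : RedSpace K F)
    (cls : ∀ f α β J, p (cls K f α β J)) (add : ∀ x y, p x → p y → p (x + y))
    (smul : ∀ (c : K) x, p x → p (c • x)) : p x := by
  obtain ⟨x, rfl⟩ := Submodule.Quotient.mk_surjective _ x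
  have key (t : RedTerm F) (c : K) : p (Submodule.Quotient.mk (Finsupp.single t c)) := by
    have := smul c _ (cls t.coeff t.init t.mon t.nest)
    rwa [IntDiff.cls, ← Submodule.Quotient.mk_smul, Finsupp.smul_single, smul_eq_mul,
      mul_one] at this
  induction x using Finsupp.induction_linear with
  | zero => simpa using key ⟨0, 0, 0, []⟩ 0
  | add x y hx hy => exact add _ _ hx hy
  | single t c => exact key t c

theorem redSpace_hom_ext {S T : RedSpace K F →ₗ[K] M}
    (h : ∀ f α β J, S (cls K f α β J) = T (cls K f α β J)) : S = T := by
  refine Submodule.linearMap_qext _ (Finsupp.lhom_ext' fun t => LinearMap.ext_ring ?_)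
  exact h t.coeff t.init t.mon t.nest

theorem isLinearMap_of_cls {T : F → RedSpace K F →ₗ[K] M}
    (h : ∀ f α β J, IsLinearMap K fun g => T g (cls K f α β J)) : IsLinearMap K T where
  map_add x y := redSpace_hom_ext fun f α β J => (h f α β J).map_add x y
  map_smul c x := redSpace_hom_ext fun f α β J => (h f α β J).map_smul c x

end Linear

/-! ### Shuffle sums -/

section Shuffle

variable {L : Type v} {M : Type w} [AddCommMonoid M]

/-- The sum of the values of a function over all shuffles of two words. -/
def shuffleSum (Φ : List L → M) (xs ys : List L) : M := ((shuffles xs ys).map Φ).sum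

@[simp]
theorem shuffleSum_nil_left (Φ : List L → M) (ys : List L) : shuffleSum Φ [] ys = Φ ys := by
  simp [shuffleSum, shuffles]

@[simp]
theorem shuffleSum_nil_right (Φ : List L → M) (xs : List L) : shuffleSum Φ xs [] = Φ xs := by
  cases xs <;> simp [shuffleSum, shuffles]

theorem shuffleSum_cons_cons (Φ : List L → M) (x y : L) (xs ys : List L) :
    shuffleSum Φ (x :: xs) (y :: ys) = shuffleSum (fun J => Φ (x :: J)) xs (y :: ys)
      + shuffleSum (fun J => Φ (y :: J)) (x :: xs) ys := by
  simp [shuffleSum, shuffles, Function.comp_def]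

theorem shuffleSum_add (Φ Ψ : List L → M) (xs ys : List L) :
    shuffleSum (fun J => Φ J + Ψ J) xs ys = shuffleSum Φ xs ys + shuffleSum Ψ xs ys := by
  simp [shuffleSum]

theorem map_shuffleSum {N : Type w'} [AddCommMonoid N] {G : Type*} [FunLike G M N]
    [AddMonoidHomClass G M N] (T : G) (Φ : List L → M) (xs ys : List L) :
    T (shuffleSum Φ xs ys) = shuffleSum (fun J => T (Φ J)) xs ys := by
  simp [shuffleSum, map_list_sum, Function.comp_def]

theorem shuffleSum_comm (Φ : List L → M) (xs ys : List L) :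
    shuffleSum Φ xs ys = shuffleSum Φ ys xs := by
  induction xs generalizing Φ ys with
  | nil => simp
  | cons x xs ih =>
    induction ys generalizing Φ with
    | nil => simp
    | cons y ys ih' => rw [shuffleSum_cons_cons, shuffleSum_cons_cons, ih, ih', add_comm]

theorem shuffleSum_assoc (Φ : List L → M) (xs ys zs : List L) :
    shuffleSum (fun J => shuffleSum Φ J zs) xs ys
      = shuffleSum (fun J => shuffleSum Φ xs J) ys zs := by
  induction xs generalizing Φ ys zs with
  | nil => simp
  | cons x xs ihx =>
    induction ys generalizing Φ zs with
    | nil => simp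
    | cons y ys ihy =>
      induction zs generalizing Φ with
      | nil => simp
      | cons z zs ihz =>
        have hl : shuffleSum (fun J => shuffleSum Φ J (z :: zs)) (x :: xs) (y :: ys)
            = shuffleSum (fun J => shuffleSum (fun J => Φ (x :: J)) J (z :: zs)) xs (y :: ys)
              + shuffleSum (fun J => shuffleSum (fun J => Φ (y :: J)) J (z :: zs)) (x :: xs) ys
              + shuffleSum (fun J => shuffleSum (fun J => Φ (z :: J)) J zs) (x :: xs) (y :: ys) := by
          rw [shuffleSum_cons_cons, shuffleSum_cons_cons (fun J => shuffleSum _ J zs)]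
          simp only [shuffleSum_cons_cons Φ, shuffleSum_add]
          abel
        have hr : shuffleSum (fun J => shuffleSum Φ (x :: xs) J) (y :: ys) (z :: zs)
            = shuffleSum (fun J => shuffleSum (fun J => Φ (x :: J)) xs J) (y :: ys) (z :: zs)
              + shuffleSum (fun J => shuffleSum (fun J => Φ (y :: J)) (x :: xs) J) ys (z :: zs)
              + shuffleSum (fun J => shuffleSum (fun J => Φ (z :: J)) (x :: xs) J) (y :: ys) zs := by
          rw [shuffleSum_cons_cons, shuffleSum_cons_cons (fun J => shuffleSum _ xs J)]
          simp only [shuffleSum_cons_cons Φ, shuffleSum_add]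
          abel
        rw [hl, hr, ihx, ihy, ihz]

end Shuffle

section NestShuffle

variable {K : Type u} {F : Type v} [CommRing K] [CommRing F] [Algebra K F]
  {M : Type w} [AddCommGroup M] [Module K M]

theorem isLinearMap_shuffleSum {L : Type*} {Ψ : F → List L → M} (xs ys : List L)
    (h : ∀ J, IsLinearMap K fun g => Ψ g J) : IsLinearMap K fun g => shuffleSum (Ψ g) xs ys :=
  isLinearMap_list_sum (φ := fun J g => Ψ g J) _ h

theorem NestLinear.shuffleSum_left {Φ : List (Letter F) → M} (h : NestLinear K Φ)
    (ys : List (Letter F)) : NestLinear K fun xs => shuffleSum Φ xs ys := by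
  induction ys generalizing Φ with
  | nil => simpa using h
  | cons y ys ih =>
    intro P γ Q
    induction P generalizing Φ with
    | nil =>
      simp only [List.nil_append, shuffleSum_cons_cons]
      exact isLinearMap_add (isLinearMap_shuffleSum _ _ fun L => h.head γ L)
        ((ih (h.tail y)).head γ Q)
    | cons x P ihP =>
      simp only [List.cons_append, shuffleSum_cons_cons]
      exact isLinearMap_add (ihP (h.tail x)) (ih (h.tail y) (x :: P) γ Q)

theorem NestLinear.shuffleSum_right {Φ : List (Letter F) → M} (h : NestLinear K Φ)
    (xs : List (Letter F)) : NestLinear K fun ys => shuffleSum Φ xs ys := by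
  simpa only [shuffleSum_comm Φ xs] using h.shuffleSum_left xs

end NestShuffle

/-! ### The ring of reduced terms -/

section Ring

variable {K : Type u} {F : Type v} [CommRing K] [CommRing F] [Algebra K F]

theorem isLinearMap_cls_mul_right (f : F) (α β : MultiIndex) (J : List (Letter F)) :
    IsLinearMap K fun g => cls K (f * g) α β J :=
  isLinearMap_comp (isLinearMap_cls _ _ _) (LinearMap.mulLeft K f)

theorem isLinearMap_cls_mul_left (g : F) (α β : MultiIndex) (J : List (Letter F)) :
    IsLinearMap K fun f => cls K (f * g) α β J :=
  isLinearMap_comp (isLinearMap_cls _ _ _) (LinearMap.mulRight K g)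

/-- Multiplication by a reduced term. -/
noncomputable def redMulCls (f : F) (α β : MultiIndex) (J : List (Letter F)) :
    RedSpace K F →ₗ[K] RedSpace K F :=
  liftRed (fun g α' β' J' => shuffleSum (cls K (f * g) (α + α') (β + β')) J J')
    (fun _ _ _ => isLinearMap_shuffleSum _ _ fun _ => isLinearMap_cls_mul_right f _ _ _)
    (fun _ _ _ => (nestLinear_cls _ _ _).shuffleSum_right J)

theorem redMulCls_cls (f g : F) (α α' β β' : MultiIndex) (J J' : List (Letter F)) :
    redMulCls f α β J (cls K g α' β' J')
      = shuffleSum (cls K (f * g) (α + α') (β + β')) J J' :=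
  liftRed_cls _ _ _ _ _ _ _

/-- The multiplication on the space of reduced terms, by means of the shuffle product. -/
noncomputable def redMul : RedSpace K F →ₗ[K] RedSpace K F →ₗ[K] RedSpace K F :=
  liftRed redMulCls
    (fun α β J => isLinearMap_of_cls fun g α' β' J' => by
      simp only [redMulCls_cls]
      exact isLinearMap_shuffleSum _ _ fun _ => isLinearMap_cls_mul_left g _ _ _)
    (fun f α β P γ Q => isLinearMap_of_cls fun g α' β' J' => by
      simp only [redMulCls_cls]
      exact (nestLinear_cls _ _ _).shuffleSum_left J' P γ Q)

theorem redMul_cls (f g : F) (α α' β β' : MultiIndex) (J J' : List (Letter F)) :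
    redMul (cls K f α β J) (cls K g α' β' J')
      = shuffleSum (cls K (f * g) (α + α') (β + β')) J J' :=
  (DFunLike.congr_fun (liftRed_cls redMulCls _ _ f α β J) _).trans
    (redMulCls_cls f g α α' β β' J J')

theorem redMul_comm (a b : RedSpace K F) : redMul a b = redMul b a := by
  suffices h : redMul = (redMul (K := K) (F := F)).flip from
    DFunLike.congr_fun (DFunLike.congr_fun h a) b
  refine redSpace_hom_ext fun f α β J => redSpace_hom_ext fun g α' β' J' => ?_
  rw [LinearMap.flip_apply, redMul_cls, redMul_cls, shuffleSum_comm, mul_comm, add_comm α,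
    add_comm β]

theorem redMul_assoc (a b c : RedSpace K F) : redMul (redMul a b) c = redMul a (redMul b c) := by
  induction a using redSpace_induction with
  | add x y hx hy => simp only [map_add, LinearMap.add_apply, hx, hy]
  | smul r x hx => simp only [map_smul, LinearMap.smul_apply, hx]
  | cls f α β J =>
  induction b using redSpace_induction with
  | add x y hx hy => simp only [map_add, LinearMap.add_apply, hx, hy]
  | smul r x hx => simp only [map_smul, LinearMap.smul_apply, hx]
  | cls g α' β' J' =>
  induction c using redSpace_induction with
  | add x y hx hy => simp only [map_add, hx, hy]
  | smul r x hx => simp only [map_smul, hx]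
  | cls g' α'' β'' J'' =>
  rw [redMul_cls, redMul_cls, redMul_comm, map_shuffleSum, map_shuffleSum]
  simp only [redMul_comm (cls K g' _ _ _), redMul_cls, shuffleSum_assoc, mul_assoc, add_assoc]

theorem redMul_one (a : RedSpace K F) : redMul (cls K 1 0 0 []) a = a := by
  suffices h : redMul (cls K 1 0 0 []) = (LinearMap.id : RedSpace K F →ₗ[K] _) from
    DFunLike.congr_fun h a
  refine redSpace_hom_ext fun f α β J => ?_
  simp [redMul_cls]

noncomputable instance : CommRing (RedSpace K F) where
  __ := (inferInstance : AddCommGroup (RedSpace K F))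
  mul a b := redMul a b
  one := cls K 1 0 0 []
  mul_assoc := redMul_assoc
  mul_comm := redMul_comm
  one_mul := redMul_one
  mul_one a := (redMul_comm _ _).trans (redMul_one a)
  left_distrib a := map_add (redMul a)
  right_distrib a b c := LinearMap.map_add₂ redMul a b c
  zero_mul := LinearMap.map_zero₂ redMul
  mul_zero a := map_zero (redMul a)

noncomputable instance : Algebra K (RedSpace K F) :=
  Algebra.ofModule (LinearMap.map_smul₂ redMul) fun c a => map_smul (redMul a) c

theorem cls_mul_cls (f g : F) (α α' β β' : MultiIndex) (J J' : List (Letter F)) :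
    cls K f α β J * cls K g α' β' J' = shuffleSum (cls K (f * g) (α + α') (β + β')) J J' :=
  redMul_cls f g α α' β β' J J'

theorem one_eq_cls : (1 : RedSpace K F) = cls K 1 0 0 [] := rfl

theorem cls_mul_cls_nil (f g : F) (α α' β β' : MultiIndex) (J : List (Letter F)) :
    cls K f α β J * cls K g α' β' [] = cls K (f * g) (α + α') (β + β') J := by
  rw [cls_mul_cls, shuffleSum_nil_right]

theorem cls_nil_mul_cls (f g : F) (α α' β β' : MultiIndex) (J : List (Letter F)) :
    cls K f α β [] * cls K g α' β' J = cls K (f * g) (α + α') (β + β') J := by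
  rw [cls_mul_cls, shuffleSum_nil_left]

end Ring

/-! ### Integro-differential algebras and their evaluation -/

section Algebra

variable {K : Type u} {A : Type v} [CommRing K] [CommRing A] [Algebra K A]
  [IntegroDifferentialAlgebra K A]

theorem der_mul (f g : A) : der K (f * g) = der K f * g + f * der K g := by
  have h := (IntegroDifferentialAlgebra.derivation (K := K) (A := A)).leibniz f g
  rw [smul_eq_mul, smul_eq_mul] at h
  exact h.trans (by rw [add_comm, mul_comm g]; rfl)

theorem der_one : der K (1 : A) = 0 :=
  (IntegroDifferentialAlgebra.derivation (K := K) (A := A)).map_one_eq_zero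

theorem der_integ (f : A) : der K (integ K f) = f :=
  IntegroDifferentialAlgebra.der_of_integ f

theorem evaluation_apply (f : A) : evaluation K f = f - integ K (der K f) := rfl

theorem integ_der (f : A) : integ K (der K f) = f - evaluation K f := by
  rw [evaluation_apply, sub_sub_cancel]

theorem der_evaluation (f : A) : der K (evaluation K f) = 0 := by
  rw [evaluation_apply, map_sub, der_integ, sub_self]

theorem evaluation_integ (f : A) : evaluation K (integ K f) = 0 := by
  rw [evaluation_apply, der_integ, sub_self]

/-- The differential Baxter identity says that the evaluation is multiplicative. -/
theorem evaluation_mul (f g : A) :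
    evaluation K (f * g) = evaluation K f * evaluation K g := by
  have h : integ K (der K f) * integ K (der K g) + integ K (der K (f * g))
    = integ K (der K f) * g + f * integ K (der K g) := IntegroDifferentialAlgebra.baxter f g
  simp only [evaluation_apply]
  linear_combination -h

theorem evaluation_of_der_eq_zero {f : A} (h : der K f = 0) : evaluation K f = f := by
  rw [evaluation_apply, h, map_zero, sub_zero]

theorem evaluation_one : evaluation K (1 : A) = 1 := evaluation_of_der_eq_zero der_one

theorem evaluation_evaluation (f : A) : evaluation K (evaluation K f) = evaluation K f :=
  evaluation_of_der_eq_zero (der_evaluation f)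

/-- Two elements with equal derivatives and equal evaluations agree. -/
theorem eq_of_der_of_evaluation {f g : A} (h : der K f = der K g)
    (h' : evaluation K f = evaluation K g) : f = g := by
  rw [evaluation_apply, evaluation_apply, h] at h'
  exact sub_left_injective h'

/-- Integration by parts. -/
theorem mul_integ (f g : A) :
    f * integ K g = integ K (f * g) + integ K (der K f * integ K g) := by
  apply eq_of_der_of_evaluation (K := K)
  · rw [der_mul, map_add, der_integ, der_integ, der_integ, add_comm]
  · rw [evaluation_mul, map_add, evaluation_integ, evaluation_integ, evaluation_integ, mul_zero,
      add_zero]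

/-- The Rota--Baxter identity. -/
theorem integ_mul_integ (f g : A) :
    integ K f * integ K g = integ K (f * integ K g) + integ K (g * integ K f) := by
  rw [mul_integ, der_integ, add_comm, mul_comm g]

end Algebra

theorem IsOrdinary.exists_evaluation_eq {K : Type u} {A : Type v} [Field K] [CommRing A]
    [Algebra K A] [IntegroDifferentialAlgebra K A] (h : IsOrdinary K A) (f : A) :
    ∃ c : K, evaluation K f = algebraMap K A c := by
  have h1 : (⟨1, der_one⟩ : LinearMap.ker (der K : A →ₗ[K] A)) ≠ 0 := by
    intro h1
    have h2 : (1 : A) = 0 := congrArg Subtype.val h1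
    have := subsingleton_of_zero_eq_one h2.symm
    rw [IsOrdinary, Module.finrank_zero_of_subsingleton] at h
    exact zero_ne_one h
  obtain ⟨c, hc⟩ := exists_smul_eq_of_finrank_eq_one h h1 ⟨evaluation K f, der_evaluation f⟩
  exact ⟨c, by rw [Algebra.algebraMap_eq_smul_one]; exact (congrArg Subtype.val hc).symm⟩

/-! ### Differential monomials -/

section Monomials

open Finsupp

namespace MultiIndex

/-- The order of a differential monomial: the index of its highest derivative. -/
def order (β : MultiIndex) : ℕ := β.support.sup id

theorem order_le {β : MultiIndex} {k : ℕ} (h : ∀ j, k < j → β j = 0) : β.order ≤ k :=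
  Finset.sup_le fun j hj => by
    by_contra hjk
    exact (Finsupp.mem_support_iff.1 hj) (h j (not_le.1 hjk))

theorem le_order {β : MultiIndex} {k : ℕ} (h : β k ≠ 0) : k ≤ β.order :=
  Finset.le_sup (f := id) (Finsupp.mem_support_iff.2 h)

theorem eq_zero_of_order_lt {β : MultiIndex} {j : ℕ} (h : β.order < j) : β j = 0 := by
  by_contra hj
  exact absurd (le_order hj) (not_le.2 h)

theorem order_ne_zero {β : MultiIndex} (h : β ≠ 0) : β β.order ≠ 0 := by
  obtain ⟨j, hj, h'⟩ := Finset.exists_mem_eq_sup β.support (Finsupp.support_nonempty_iff.2 h) id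
  rw [order, h']
  exact Finsupp.mem_support_iff.1 hj

theorem exists_eq_add_single {β : MultiIndex} (h : β ≠ 0) :
    ∃ (V : MultiIndex) (k b : ℕ), (∀ j, k ≤ j → V j = 0) ∧ β = V + single k (b + 1) := by
  refine ⟨β.erase β.order, β.order, β β.order - 1, fun j hj => ?_, ?_⟩
  · rcases hj.eq_or_lt with rfl | hj
    · simp
    · rw [Finsupp.erase_ne hj.ne', eq_zero_of_order_lt hj]
  · rw [Nat.sub_add_cancel (Nat.pos_of_ne_zero (order_ne_zero h)), Finsupp.erase_add_single]

/-- The quasilinear monomials are those of the form `V u_k^b u_{k+1}`, with `V` a monomial in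
`u_0, …, u_{k-1}`. -/
theorem IsQuasilinear.exists_eq {β : MultiIndex} (h : β.IsQuasilinear) :
    ∃ (V : MultiIndex) (k b : ℕ), (∀ j, k ≤ j → V j = 0) ∧
      β = V + single k b + single (k + 1) 1 := by
  obtain ⟨k, hk, h⟩ := h
  refine ⟨β.filter (· < k), k, β k, fun j hj => by simp [hj], ?_⟩
  ext j
  simp only [Finsupp.add_apply, Finsupp.filter_apply, Finsupp.single_apply]
  rcases lt_trichotomy j k with hj | rfl | hj
  · simp [hj, hj.ne', (show k + 1 ≠ j by omega)]
  · simp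
  · rcases (Nat.succ_le_of_lt hj).eq_or_lt with rfl | hj'
    · simp [hk]
    · simp [h j hj', hj.ne, hj'.ne]

theorem isQuasilinear_add {V : MultiIndex} {k : ℕ} (b : ℕ) (hV : ∀ j, k ≤ j → V j = 0) :
    (V + single k b + single (k + 1) 1).IsQuasilinear := by
  refine ⟨k, by simp [hV], fun j hj => ?_⟩
  simp [hV j (by omega), hj.ne, (show k ≠ j by omega)]

theorem IsQuasilinear.ne_zero {β : MultiIndex} (h : β.IsQuasilinear) : β ≠ 0 := by
  rintro rfl
  obtain ⟨k, hk, -⟩ := h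
  simp at hk

theorem trichotomy (β : MultiIndex) : β = 0 ∨ β.IsFunctional ∨ β.IsQuasilinear := by
  by_cases h0 : β = 0
  · exact .inl h0
  by_cases hq : β.IsQuasilinear
  · exact .inr (.inr hq)
  · exact .inr (.inl ⟨h0, hq⟩)

/-- Induction along the recursion that integrates monomials: a quasilinear monomial
`V u_k^b u_{k+1}` is reduced to monomials of order at most `k`. -/
@[elab_as_elim]
theorem integ_induction {p : MultiIndex → Prop} (β : MultiIndex) (zero : p 0)
    (functional : ∀ β, β.IsFunctional → p β)
    (quasilinear : ∀ (V : MultiIndex) (k b : ℕ), (∀ j, k ≤ j → V j = 0) →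
      (∀ W : MultiIndex, (∀ j, k < j → W j = 0) → p W) →
      p (V + single k b + single (k + 1) 1)) : p β := by
  induction h : β.order using Nat.strong_induction_on generalizing β with
  | _ n ih =>
  rcases β.trichotomy with rfl | hf | hq
  · exact zero
  · exact functional β hf
  · obtain ⟨V, k, b, hV, rfl⟩ := hq.exists_eq
    refine quasilinear V k b hV fun W hW => ih _ ?_ W rfl
    rw [← h]
    exact (order_le hW).trans_lt (le_order (k := k + 1) (by simp))

end MultiIndex

variable {K : Type u} [CommRing K] {M : Type w} [AddCommGroup M] [Module K M]

variable (K) in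
/-- The Leibniz rule for monomials: for a function `Ψ` on monomials, the value at `(u^β)'` of its
linear extension. -/
noncomputable def derMon (Ψ : MultiIndex → M) (β : MultiIndex) : M :=
  β.sum fun i n => (n : K) • Ψ (β - single i 1 + single (i + 1) 1)

theorem derMon_eq_sum (Ψ : MultiIndex → M) {β : MultiIndex} {s : Finset ℕ} (h : β.support ⊆ s) :
    derMon K Ψ β = ∑ i ∈ s, (β i : K) • Ψ (β - single i 1 + single (i + 1) 1) :=
  Finsupp.sum_of_support_subset _ h _ (by simp)

theorem derMon_add (Ψ : MultiIndex → M) (β β' : MultiIndex) :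
    derMon K Ψ (β + β') = derMon K (fun W => Ψ (W + β')) β + derMon K (fun W => Ψ (β + W)) β' := by
  have hs : (β + β').support ⊆ β.support ∪ β'.support := Finsupp.support_add
  rw [derMon_eq_sum _ hs, derMon_eq_sum _ Finset.subset_union_left,
    derMon_eq_sum _ Finset.subset_union_right, ← Finset.sum_add_distrib]
  refine Finset.sum_congr rfl fun i _ => ?_
  have h1 : (β i : K) • Ψ (β + β' - single i 1 + single (i + 1) 1)
      = (β i : K) • Ψ (β - single i 1 + single (i + 1) 1 + β') := by
    rcases Nat.eq_zero_or_pos (β i) with h | h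
    · simp [h]
    · congr 2
      ext j
      simp only [Finsupp.add_apply, Finsupp.tsub_apply, Finsupp.single_apply]
      split_ifs <;> subst_vars <;> omega
  have h2 : (β' i : K) • Ψ (β + β' - single i 1 + single (i + 1) 1)
      = (β' i : K) • Ψ (β + (β' - single i 1 + single (i + 1) 1)) := by
    rcases Nat.eq_zero_or_pos (β' i) with h | h
    · simp [h]
    · congr 2
      ext j
      simp only [Finsupp.add_apply, Finsupp.tsub_apply, Finsupp.single_apply]
      split_ifs <;> subst_vars <;> omega
  rw [Finsupp.add_apply, Nat.cast_add, add_smul, h1, h2]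

@[simp]
theorem derMon_zero (Ψ : MultiIndex → M) : derMon K Ψ 0 = 0 := Finsupp.sum_zero_index

theorem derMon_single (Ψ : MultiIndex → M) (k n : ℕ) :
    derMon K Ψ (single k n) = (n : K) • Ψ (single k (n - 1) + single (k + 1) 1) := by
  rw [derMon, Finsupp.sum_single_index (by simp), ← Finsupp.single_tsub]

theorem map_derMon {N : Type w'} [AddCommGroup N] [Module K N] (T : M →ₗ[K] N)
    (Ψ : MultiIndex → M) (β : MultiIndex) : T (derMon K Ψ β) = derMon K (fun W => T (Ψ W)) β := by
  simp [derMon, Finsupp.sum, map_sum]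

/-- The derivative `(V u_k^{b+1})' = V' u_k^{b+1} + (b+1) V u_k^b u_{k+1}`. -/
theorem derMon_add_single (Ψ : MultiIndex → M) (V : MultiIndex) (k b : ℕ) :
    derMon K Ψ (V + single k (b + 1)) = derMon K (fun W => Ψ (W + single k (b + 1))) V
      + ((b + 1 : ℕ) : K) • Ψ (V + single k b + single (k + 1) 1) := by
  rw [derMon_add, derMon_single, Nat.add_sub_cancel, add_assoc]

theorem derMon_congr {Ψ Ψ' : MultiIndex → M} {V : MultiIndex}
    (h : ∀ i, V i ≠ 0 → Ψ (V - single i 1 + single (i + 1) 1)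
      = Ψ' (V - single i 1 + single (i + 1) 1)) : derMon K Ψ V = derMon K Ψ' V :=
  Finset.sum_congr rfl fun i hi => by
    simp only [h i (Finsupp.mem_support_iff.1 hi)]

theorem shuffleSum_derMon {L : Type*} (Ψ : MultiIndex → List L → M) (β : MultiIndex)
    (xs ys : List L) : shuffleSum (fun J => derMon K (fun W => Ψ W J) β) xs ys
      = derMon K (fun W => shuffleSum (Ψ W) xs ys) β := by
  simp only [shuffleSum]
  induction shuffles xs ys with
  | nil => simp [derMon]
  | cons J l ih =>
    simp only [List.map_cons, List.sum_cons, ih]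
    simp [derMon, Finsupp.sum, Finset.sum_add_distrib]

theorem isLinearMap_derMon {F : Type v} [AddCommGroup F] [Module K F] {Ψ : F → MultiIndex → M}
    {V : MultiIndex} (h : ∀ i, V i ≠ 0 → IsLinearMap K fun f =>
      Ψ f (V - single i 1 + single (i + 1) 1)) : IsLinearMap K fun f => derMon K (Ψ f) V := by
  constructor
  · intro x y
    simp only [derMon, Finsupp.sum, ← Finset.sum_add_distrib, ← smul_add]
    refine Finset.sum_congr rfl fun i hi => ?_
    rw [(h i (Finsupp.mem_support_iff.1 hi)).map_add]
  · intro c x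
    simp only [derMon, Finsupp.sum, Finset.smul_sum]
    refine Finset.sum_congr rfl fun i hi => ?_
    rw [(h i (Finsupp.mem_support_iff.1 hi)).map_smul, smul_comm]

end Monomials

/-! ### The derivation and the evaluation of reduced terms -/

section Derivation

variable {K : Type u} {F : Type v} [CommRing K] [CommRing F] [Algebra K F]

theorem isLinearMap_clsMulDerNest (α β : MultiIndex) (J : List (Letter F)) :
    IsLinearMap K fun f => clsMulDerNest K f α β J := by
  cases J with
  | nil => exact isLinearMap_zero
  | cons x J => exact isLinearMap_cls_mul_left x.1 _ _ _

theorem nestLinear_clsMulDerNest (f : F) (α β : MultiIndex) :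
    NestLinear K (clsMulDerNest K f α β) :=
  .of_cons (fun _ _ => isLinearMap_cls_mul_right f _ _ _) fun x => nestLinear_cls (f * x.1) _ _

theorem isLinearMap_clsIntMulDerNest (α : MultiIndex) (J : List (Letter F)) :
    IsLinearMap K fun f => clsIntMulDerNest K f α J := by
  cases J with
  | nil => exact isLinearMap_zero
  | cons x J =>
    exact isLinearMap_comp ((nestLinear_cls 1 α 0).head x.2 J) (LinearMap.mulRight K x.1)

theorem nestLinear_clsIntMulDerNest (f : F) (α : MultiIndex) :
    NestLinear K (clsIntMulDerNest K f α) :=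
  .of_cons
    (fun γ J => isLinearMap_comp ((nestLinear_cls 1 α 0).head γ J) (LinearMap.mulLeft K f))
    fun x => (nestLinear_cls 1 α 0).tail (f * x.1, x.2)

theorem isLinearMap_clsEval (α : MultiIndex) (J : List (Letter F)) :
    IsLinearMap K fun f => clsEval K f α J := by
  cases J with
  | nil => exact isLinearMap_cls _ _ _
  | cons x J => exact isLinearMap_zero

theorem nestLinear_clsEval (f : F) (α : MultiIndex) : NestLinear K (clsEval K f α) :=
  .of_cons (fun _ _ => isLinearMap_zero) fun _ _ _ _ => isLinearMap_zero

variable (K) in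
/-- The class `[f u(0)^α u^β J]` as a linear function of `f`. -/
noncomputable def clsLin (α β : MultiIndex) (J : List (Letter F)) : F →ₗ[K] RedSpace K F :=
  (isLinearMap_cls α β J).mk' _

variable (K) in
/-- The class `[f u(0)^α κ(J)]` as a linear function of `f`. -/
noncomputable def clsEvalLin (α : MultiIndex) (J : List (Letter F)) : F →ₗ[K] RedSpace K F :=
  (isLinearMap_clsEval α J).mk' _

theorem cls_mul_clsEval (f g : F) (α α' : MultiIndex) (J : List (Letter F)) :
    cls K g α' 0 [] * clsEval K f α J = clsEval K (g * f) (α' + α) J := by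
  cases J with
  | nil => exact cls_nil_mul_cls _ _ _ _ _ _ _
  | cons x J => exact mul_zero _

theorem cls_mul_clsMulDerNest (f g : F) (α α' β β' : MultiIndex) (J : List (Letter F)) :
    cls K g α' β' [] * clsMulDerNest K f α β J = clsMulDerNest K (g * f) (α' + α) (β' + β) J := by
  cases J with
  | nil => exact mul_zero _
  | cons x J =>
    rw [clsMulDerNest, clsMulDerNest, cls_nil_mul_cls, mul_assoc, add_assoc]

theorem cls_mul_clsIntMulDerNest (f : F) (α α' : MultiIndex) (J : List (Letter F)) :
    cls K 1 α' 0 [] * clsIntMulDerNest K f α J = clsIntMulDerNest K f (α' + α) J := by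
  cases J with
  | nil => exact mul_zero _
  | cons x J => rw [clsIntMulDerNest, clsIntMulDerNest, cls_nil_mul_cls, one_mul, add_zero]

/-- The derivative of a shuffle product of integral terms. -/
theorem shuffleSum_clsMulDerNest (f g : F) (α α' β β' : MultiIndex) (J J' : List (Letter F)) :
    shuffleSum (clsMulDerNest K (f * g) (α + α') (β + β')) J J'
      = clsMulDerNest K f α β J * cls K g α' β' J'
        + cls K f α β J * clsMulDerNest K g α' β' J' := by
  cases J with
  | nil =>
    rw [shuffleSum_nil_left]
    cases J' with
    | nil => simp [clsMulDerNest]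
    | cons y J' =>
      simp only [clsMulDerNest, zero_mul, zero_add, cls_nil_mul_cls, mul_assoc, add_assoc]
  | cons x J =>
    cases J' with
    | nil =>
      simp only [shuffleSum_nil_right, clsMulDerNest, mul_zero, add_zero, cls_mul_cls_nil]
      rw [mul_right_comm, add_right_comm β]
    | cons y J' =>
      simp only [shuffleSum_cons_cons, clsMulDerNest, cls_mul_cls]
      rw [mul_right_comm f g, add_right_comm β β' x.2.1, mul_assoc f x.1,
        mul_assoc f g y.1, add_assoc β β' y.2.1]

theorem derMon_mul_right (Ψ : MultiIndex → RedSpace K F) (β : MultiIndex) (x : RedSpace K F) :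
    derMon K Ψ β * x = derMon K (fun W => Ψ W * x) β :=
  map_derMon (LinearMap.mulRight K x) Ψ β

theorem derMon_mul_left (Ψ : MultiIndex → RedSpace K F) (β : MultiIndex) (x : RedSpace K F) :
    x * derMon K Ψ β = derMon K (fun W => x * Ψ W) β :=
  map_derMon (LinearMap.mulLeft K x) Ψ β

variable [IntegroDifferentialAlgebra K F]

/-- The derivation on the space of reduced terms. -/
noncomputable def redDer : RedSpace K F →ₗ[K] RedSpace K F :=
  liftRed (fun f α β J => cls K (der K f) α β J + derMon K (fun W => cls K f α W J) β
      + clsMulDerNest K f α β J)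
    (fun _ _ _ => isLinearMap_add (isLinearMap_add (isLinearMap_comp (isLinearMap_cls _ _ _) _)
      (isLinearMap_derMon fun _ _ => isLinearMap_cls _ _ _)) (isLinearMap_clsMulDerNest _ _ _))
    (fun _ _ _ => ((nestLinear_cls _ _ _).add
      (fun P γ Q => isLinearMap_derMon fun _ _ => nestLinear_cls _ _ _ P γ Q)).add
        (nestLinear_clsMulDerNest _ _ _))

theorem redDer_cls (f : F) (α β : MultiIndex) (J : List (Letter F)) :
    redDer (cls K f α β J) = cls K (der K f) α β J + derMon K (fun W => cls K f α W J) β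
      + clsMulDerNest K f α β J :=
  liftRed_cls _ _ _ _ _ _ _

theorem redDer_mul (a b : RedSpace K F) : redDer (a * b) = redDer a * b + a * redDer b := by
  induction a using redSpace_induction with
  | add x y hx hy => simp only [add_mul, map_add, hx, hy]; ring
  | smul r x hx => simp only [smul_mul_assoc, map_smul, hx, smul_add]
  | cls f α β J =>
  induction b using redSpace_induction with
  | add x y hx hy => simp only [mul_add, map_add, hx, hy]; ring
  | smul r x hx => simp only [mul_smul_comm, map_smul, hx, smul_add]
  | cls g α' β' J' =>
  have hmon : shuffleSum (fun L => derMon K (fun W => cls K (f * g) (α + α') W L) (β + β')) J J'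
      = derMon K (fun W => cls K f α W J) β * cls K g α' β' J'
        + cls K f α β J * derMon K (fun W => cls K g α' W J') β' := by
    simp only [derMon_mul_right, derMon_mul_left, cls_mul_cls, derMon_add, shuffleSum_add,
      shuffleSum_derMon]
  rw [cls_mul_cls, map_shuffleSum]
  simp only [redDer_cls, shuffleSum_add, hmon, shuffleSum_clsMulDerNest, der_mul,
    (isLinearMap_cls _ _ _).map_add, ← cls_mul_cls]
  ring

end Derivation

section Evaluation

variable {K : Type u} {F : Type v} [CommRing K] [CommRing F] [Algebra K F]

theorem shuffleSum_clsEval (f g : F) (α α' : MultiIndex) (J J' : List (Letter F)) :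
    shuffleSum (clsEval K (f * g) (α + α')) J J' = clsEval K f α J * clsEval K g α' J' := by
  cases J with
  | nil => rw [shuffleSum_nil_left]; exact (cls_mul_clsEval _ _ _ _ _).symm
  | cons x J =>
    cases J' with
    | nil => rw [shuffleSum_nil_right]; exact (zero_mul _).symm
    | cons y J' => rw [shuffleSum_cons_cons]; simp [clsEval, shuffleSum]

variable [IntegroDifferentialAlgebra K F]

/-- The evaluation on the space of reduced terms: it sends `f u(0)^α u^β J` to
`f(0) u(0)^(α + β)` if `J = 1`, and to zero otherwise. -/
noncomputable def redEval : RedSpace K F →ₗ[K] RedSpace K F :=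
  liftRed (fun f α β J => clsEval K (evaluation K f) (α + β) J)
    (fun _ _ _ => isLinearMap_comp (isLinearMap_clsEval _ _) _)
    (fun _ _ _ => nestLinear_clsEval _ _)

theorem redEval_cls (f : F) (α β : MultiIndex) (J : List (Letter F)) :
    redEval (cls K f α β J) = clsEval K (evaluation K f) (α + β) J :=
  liftRed_cls _ _ _ _ _ _ _

theorem redEval_mul (a b : RedSpace K F) : redEval (a * b) = redEval a * redEval b := by
  induction a using redSpace_induction with
  | add x y hx hy => simp only [add_mul, map_add, hx, hy]
  | smul r x hx => simp only [smul_mul_assoc, map_smul, hx]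
  | cls f α β J =>
  induction b using redSpace_induction with
  | add x y hx hy => simp only [mul_add, map_add, hx, hy]
  | smul r x hx => simp only [mul_smul_comm, map_smul, hx]
  | cls g α' β' J' =>
  rw [cls_mul_cls, map_shuffleSum]
  simp only [redEval_cls, evaluation_mul, add_add_add_comm α, shuffleSum_clsEval]

theorem redDer_clsEval (f : F) (α : MultiIndex) (J : List (Letter F)) :
    redDer (clsEval K (evaluation K f) α J) = 0 := by
  cases J with
  | nil =>
    rw [clsEval, redDer_cls, der_evaluation, (isLinearMap_cls _ _ _).map_zero, derMon_zero]
    simp [clsMulDerNest]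
  | cons x J => exact map_zero _

theorem redDer_cls_init (α : MultiIndex) (x : RedSpace K F) :
    redDer (cls K 1 α 0 [] * x) = cls K 1 α 0 [] * redDer x := by
  rw [redDer_mul, redDer_cls, der_one, (isLinearMap_cls _ _ _).map_zero]
  simp [clsMulDerNest]

end Evaluation

/-! ### The integral of reduced terms -/

section Integral

open Finsupp MultiIndex

variable {K : Type u} {F : Type v} [Field K] [CommRing F] [Algebra K F]
  [IntegroDifferentialAlgebra K F]

namespace MultiIndex

/-- The monomial `V u_k^(b+1)` attached to the quasilinear monomial `V u_k^b u_{k+1}`. -/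
noncomputable def lower (β : MultiIndex) : MultiIndex :=
  β.filter (· < β.order) + single (β.order - 1) 1

theorem order_quasilinear {V : MultiIndex} {k : ℕ} (b : ℕ) (hV : ∀ j, k ≤ j → V j = 0) :
    (V + single k b + single (k + 1) 1).order = k + 1 :=
  le_antisymm
    (order_le fun j hj => by simp [hV j (by omega), hj.ne, (show k ≠ j by omega)])
    (le_order (by simp))

theorem lower_quasilinear {V : MultiIndex} {k : ℕ} (b : ℕ) (hV : ∀ j, k ≤ j → V j = 0) :
    (V + single k b + single (k + 1) 1).lower = V + single k (b + 1) := by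
  rw [lower, order_quasilinear b hV, Nat.add_sub_cancel, Finsupp.single_add, ← add_assoc]
  congr 1
  ext j
  simp only [Finsupp.filter_apply, Finsupp.add_apply, Finsupp.single_apply]
  rcases lt_or_ge j (k + 1) with hj | hj
  · simp [hj, hj.ne']
  · simp [hj.not_gt, hV j (by omega), (show k ≠ j by omega)]

theorem add_single_apply_eq_zero {V : MultiIndex} {k : ℕ} (b : ℕ) (hV : ∀ j, k ≤ j → V j = 0) :
    ∀ j, k < j → (V + single k b : MultiIndex) j = 0 := fun j hj => by
  simp [hV j hj.le, hj.ne]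

/-- The monomials of `V' u_k^b` have order at most `k`. -/
theorem der_add_single_apply_eq_zero {V : MultiIndex} {k : ℕ} (b : ℕ)
    (hV : ∀ j, k ≤ j → V j = 0) {i : ℕ} (hi : V i ≠ 0) :
    ∀ j, k < j → (V - single i 1 + single (i + 1) 1 + single k b : MultiIndex) j = 0 := by
  intro j hj
  have hik : i < k := by
    by_contra h
    exact hi (hV i (not_lt.1 h))
  simp [hV j hj.le, hj.ne, (show i + 1 ≠ j by omega)]

end MultiIndex

/-- The integral of `f u^β J`, as a linear function of `f`, where `prev γ f` stands for the
integral of `f u^γ J'`. For `u^β = V u_k^b u_{k+1}`, integration by parts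
leads to the monomials of `V' u_k^(b+1)`, whose order is at most `k`; the sum over `i : Fin k` is
the Leibniz rule for `V'`, written so that the bound `i < k` is available for termination. -/
noncomputable def integMon (J : List (Letter F)) (prev : MultiIndex → F →ₗ[K] RedSpace K F)
    (β : MultiIndex) : F →ₗ[K] RedSpace K F :=
  open Classical in
  if h0 : β = 0 then
    (isLinearMap_sub (isLinearMap_cls (K := K) 0 0 J)
      (isLinearMap_clsIntMulDerNest 0 J)).mk' _ ∘ₗ integ K
  else if hf : β.IsFunctional then
    ((nestLinear_cls (K := K) 1 0 0).head ⟨β, hf⟩ J).mk' _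
  else
    ((β (β.order - 1) + 1 : ℕ) : K)⁻¹ •
      (clsLin K 0 β.lower J
        - (integMon J prev β.lower ∘ₗ der K
          + ∑ i : Fin (β.order - 1),
            (β i : K) • integMon J prev (β.lower - single i.1 1 + single (i.1 + 1) 1)
          + prev β.lower)
        - clsEvalLin K β.lower J ∘ₗ evaluation K)
termination_by β.order
decreasing_by
  all_goals
    have hq := (β.trichotomy.resolve_left h0).resolve_left hf
    obtain ⟨V, k, b, hV, rfl⟩ := hq.exists_eq
    rw [lower_quasilinear b hV]
    refine lt_of_lt_of_eq (Nat.lt_succ_of_le (order_le ?_)) (order_quasilinear b hV).symm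
  · exact add_single_apply_eq_zero _ hV
  · have hi : i.1 < k :=
      lt_of_lt_of_eq i.2 (by rw [order_quasilinear b hV, Nat.add_sub_cancel])
    intro j hj
    simp [hV j hj.le, hj.ne, (show i.1 + 1 ≠ j by omega)]

/-- The integral of `f u^β J`, as a linear function of `f`. -/
noncomputable def integNest : List (Letter F) → MultiIndex → F →ₗ[K] RedSpace K F
  | [] => integMon [] 0
  | (g, γ) :: J => integMon ((g, γ) :: J) fun β => integNest J (β + γ.1) ∘ₗ LinearMap.mulRight K g

variable (K) in
/-- The integral of `f u^β J'`, where `J'` is the derivative of the integral term `J`. -/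
noncomputable def integMulDerNest (f : F) (β : MultiIndex) : List (Letter F) → RedSpace K F
  | [] => 0
  | (g, γ) :: J => integNest J (β + γ.1) (f * g)

theorem integMon_zero (J : List (Letter F)) (prev : MultiIndex → F →ₗ[K] RedSpace K F) (f : F) :
    integMon J prev 0 f = cls K (integ K f) 0 0 J - clsIntMulDerNest K (integ K f) 0 J := by
  rw [integMon, dif_pos rfl]
  rfl

theorem integMon_functional (J : List (Letter F)) (prev : MultiIndex → F →ₗ[K] RedSpace K F)
    {β : MultiIndex} (hβ : β.IsFunctional) (f : F) :
    integMon J prev β f = cls K 1 0 0 ((f, ⟨β, hβ⟩) :: J) := by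
  rw [integMon, dif_neg hβ.1, dif_pos hβ]
  rfl

theorem integMon_quasilinear [CharZero K] (J : List (Letter F))
    (prev : MultiIndex → F →ₗ[K] RedSpace K F) {V : MultiIndex} {k : ℕ} (b : ℕ)
    (hV : ∀ j, k ≤ j → V j = 0) (f : F) :
    ((b + 1 : ℕ) : K) • integMon J prev (V + single k b + single (k + 1) 1) f
      = cls K f 0 (V + single k (b + 1)) J
        - (integMon J prev (V + single k (b + 1)) (der K f)
          + derMon K (fun W => integMon J prev (W + single k (b + 1)) f) V
          + prev (V + single k (b + 1)) f)
        - clsEval K (evaluation K f) (V + single k (b + 1)) J := by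
  have hq := isQuasilinear_add b hV
  have hs : V.support ⊆ Finset.range k := fun j hj => by
    rw [Finset.mem_range]
    by_contra h
    exact (Finsupp.mem_support_iff.1 hj) (hV j (not_lt.1 h))
  have hb : (((b + 1 : ℕ) : K)) ≠ 0 := Nat.cast_ne_zero.2 b.succ_ne_zero
  rw [integMon, dif_neg hq.ne_zero, dif_neg fun h => h.2 hq]
  have hc : (V + single k b + single (k + 1) 1 : MultiIndex)
      ((V + single k b + single (k + 1) 1 : MultiIndex).order - 1) = b := by
    simp [order_quasilinear b hV, hV]
  have hsum : (∑ i : Fin ((V + single k b + single (k + 1) 1 : MultiIndex).order - 1),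
      ((V + single k b + single (k + 1) 1 : MultiIndex) i : K) •
        integMon J prev (V + single k (b + 1) - single i.1 1 + single (i.1 + 1) 1)) f
      = derMon K (fun W => integMon J prev (W + single k (b + 1)) f) V := by
    rw [derMon_eq_sum _ hs, LinearMap.sum_apply, order_quasilinear b hV, Nat.add_sub_cancel,
      ← Fin.sum_univ_eq_sum_range (fun i => (V i : K) •
        integMon J prev (V - single i 1 + single (i + 1) 1 + single k (b + 1)) f)]
    refine Finset.sum_congr rfl fun i _ => ?_
    have hi := i.2
    rcases Nat.eq_zero_or_pos (V i) with h | h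
    · simp [h, hi.ne', (show k + 1 ≠ i.1 by omega)]
    · rw [LinearMap.smul_apply]
      congr 2
      · simp [hi.ne', (show k + 1 ≠ i.1 by omega)]
      · congr 1
        ext j
        simp only [Finsupp.add_apply, Finsupp.tsub_apply, Finsupp.single_apply]
        split_ifs <;> subst_vars <;> omega
  rw [hc, lower_quasilinear b hV, LinearMap.smul_apply, smul_inv_smul₀ hb, LinearMap.sub_apply,
    LinearMap.sub_apply, LinearMap.add_apply, LinearMap.add_apply, hsum]
  rfl

theorem integNest_zero (J : List (Letter F)) (f : F) :
    integNest J 0 f = cls K (integ K f) 0 0 J - clsIntMulDerNest K (integ K f) 0 J := by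
  cases J <;> exact integMon_zero _ _ _

theorem integNest_functional (J : List (Letter F)) {β : MultiIndex} (hβ : β.IsFunctional) (f : F) :
    integNest J β f = cls K 1 0 0 ((f, ⟨β, hβ⟩) :: J) := by
  cases J <;> exact integMon_functional _ _ _ _

theorem integNest_quasilinear [CharZero K] (J : List (Letter F)) {V : MultiIndex} {k : ℕ} (b : ℕ)
    (hV : ∀ j, k ≤ j → V j = 0) (f : F) :
    ((b + 1 : ℕ) : K) • integNest J (V + single k b + single (k + 1) 1) f
      = cls K f 0 (V + single k (b + 1)) J
        - (integNest J (V + single k (b + 1)) (der K f)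
          + derMon K (fun W => integNest J (W + single k (b + 1)) f) V
          + integMulDerNest K f (V + single k (b + 1)) J)
        - clsEval K (evaluation K f) (V + single k (b + 1)) J := by
  cases J <;> exact integMon_quasilinear _ _ b hV f

theorem isLinearMap_integNest [CharZero K] {P Q : List (Letter F)} {γ}
    (h : ∀ f β, IsLinearMap K fun g => integMulDerNest K f β (P ++ (g, γ) :: Q)) (β : MultiIndex)
    (f : F) : IsLinearMap K fun g => integNest (K := K) (P ++ (g, γ) :: Q) β f := by
  induction β using MultiIndex.integ_induction generalizing f with
  | zero =>
    simp only [integNest_zero]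
    exact isLinearMap_sub (nestLinear_cls _ _ _ P γ Q) (nestLinear_clsIntMulDerNest _ _ P γ Q)
  | functional β hβ =>
    simp only [integNest_functional _ hβ]
    exact (nestLinear_cls _ _ _).tail _ P γ Q
  | quasilinear V k b hV ih =>
    have hb : (((b + 1 : ℕ) : K)) ≠ 0 := Nat.cast_ne_zero.2 b.succ_ne_zero
    simp only [(eq_inv_smul_iff₀ hb).2 (integNest_quasilinear _ b hV f)]
    refine isLinearMap_smul _ (isLinearMap_sub (isLinearMap_sub (nestLinear_cls _ _ _ P γ Q)
      (isLinearMap_add (isLinearMap_add ?_ ?_) (h _ _))) (nestLinear_clsEval _ _ P γ Q))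
    · exact ih _ (add_single_apply_eq_zero _ hV) _
    · exact isLinearMap_derMon fun i hi => ih _ (der_add_single_apply_eq_zero _ hV hi) _

theorem nestLinear_integNest [CharZero K] (β : MultiIndex) (f : F) :
    NestLinear K fun J => integNest (K := K) J β f := by
  intro P γ Q
  induction P generalizing β f with
  | nil =>
    exact isLinearMap_integNest (fun f β => isLinearMap_comp (integNest Q _).isLinear
      (LinearMap.mulLeft K f)) β f
  | cons x P ih => exact isLinearMap_integNest (P := x :: P) (fun f β => ih _ _) β f

/-- The integral on the space of reduced terms. -/
noncomputable def redInteg [CharZero K] : RedSpace K F →ₗ[K] RedSpace K F :=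
  liftRed (fun f α β J => cls K 1 α 0 [] * integNest J β f)
    (fun α β J => isLinearMap_apply (LinearMap.mulLeft K (cls K 1 α 0 [])) (integNest J β).isLinear)
    (fun f α β => (nestLinear_integNest β f).apply (LinearMap.mulLeft K (cls K 1 α 0 [])))

variable [CharZero K]

theorem redInteg_cls (f : F) (α β : MultiIndex) (J : List (Letter F)) :
    redInteg (cls K f α β J) = cls K 1 α 0 [] * integNest J β f :=
  liftRed_cls _ _ _ _ _ _ _

theorem redInteg_cls_zero (f : F) (β : MultiIndex) (J : List (Letter F)) :
    redInteg (cls K f 0 β J) = integNest J β f := by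
  rw [redInteg_cls, ← one_eq_cls, one_mul]

theorem redInteg_clsMulDerNest (f : F) (β : MultiIndex) (J : List (Letter F)) :
    redInteg (clsMulDerNest K f 0 β J) = integMulDerNest K f β J := by
  cases J with
  | nil => exact map_zero _
  | cons x J => exact redInteg_cls_zero _ _ _

theorem redDer_integNest (J : List (Letter F)) (β : MultiIndex) (f : F) :
    redDer (integNest J β f) = cls K f 0 β J := by
  have key : ∀ J : List (Letter F),
      (∀ f β, redDer (integMulDerNest K f β J) = clsMulDerNest K f 0 β J) →
      ∀ f β, redDer (integNest J β f) = cls K f 0 β J := by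
    intro J h f β
    induction β using MultiIndex.integ_induction generalizing f with
    | zero =>
      rw [integNest_zero, map_sub, redDer_cls, der_integ, derMon_zero]
      cases J with
      | nil => simp [clsMulDerNest, clsIntMulDerNest]
      | cons x J =>
        rw [clsIntMulDerNest, redDer_cls, der_one, (isLinearMap_cls _ _ _).map_zero, derMon_zero]
        simp [clsMulDerNest]
    | functional β hβ =>
      rw [integNest_functional _ hβ, redDer_cls, der_one, (isLinearMap_cls _ _ _).map_zero]
      simp [clsMulDerNest]
    | quasilinear V k b hV ih =>
      have hb : (((b + 1 : ℕ) : K)) ≠ 0 := Nat.cast_ne_zero.2 b.succ_ne_zero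
      apply smul_right_injective _ hb
      simp only
      rw [← map_smul, integNest_quasilinear _ b hV, map_sub, map_sub, map_add, map_add,
        redDer_clsEval, redDer_cls, derMon_add_single, map_derMon, h,
        ih _ (add_single_apply_eq_zero _ hV),
        derMon_congr (Ψ := fun W => redDer (integNest J (W + single k (b + 1)) f))
          (Ψ' := fun W => cls K f 0 (W + single k (b + 1)) J) fun i hi =>
            ih _ (der_add_single_apply_eq_zero _ hV hi) _]
      abel
  induction J generalizing β f with
  | nil => exact key [] (fun _ _ => map_zero _) f β
  | cons x J ih => exact key (x :: J) (fun f β => ih (β + x.2.1) (f * x.1)) f β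

theorem redDer_redInteg (x : RedSpace K F) : redDer (redInteg x) = x := by
  suffices h : redDer ∘ₗ redInteg = (LinearMap.id : RedSpace K F →ₗ[K] _) from
    DFunLike.congr_fun h x
  refine redSpace_hom_ext fun f α β J => ?_
  rw [LinearMap.comp_apply, redInteg_cls, redDer_cls_init, redDer_integNest, cls_nil_mul_cls]
  simp

variable (K F) in
/-- The operations on the space of reduced terms. -/
noncomputable def redOperations : Operations K (RedSpace K F) := ⟨1, redMul, redDer, redInteg⟩

theorem isReducedOperations_redOperations : IsReducedOperations (redOperations K F) where
  one_eq := rfl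
  mul_eq := redMul_cls
  der_eq := redDer_cls
  integ_quasiconstant f α J := by
    change redInteg _ = _
    rw [redInteg_cls, integNest_zero, mul_sub, cls_nil_mul_cls, cls_mul_clsIntMulDerNest]
    simp
  integ_quasilinear f α V k b J hV := by
    change redInteg _ = _ - cls K 1 α 0 [] * redInteg (redDer (cls K f 0 V J) *
      cls K 1 0 (single k (b + 1)) []) - _
    rw [map_smul, redInteg_cls, ← mul_smul_comm, integNest_quasilinear J b hV, redDer_cls, add_mul,
      add_mul, mul_comm (clsMulDerNest K f 0 V J), cls_mul_clsMulDerNest, derMon_mul_right,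
      map_add, map_add, map_derMon]
    simp only [cls_mul_cls_nil, mul_one, add_zero, one_mul, add_comm (single k (b + 1)) V,
      redInteg_clsMulDerNest, redInteg_cls_zero, mul_sub, cls_mul_clsEval, cls_nil_mul_cls,
      zero_add]
  integ_functional f α β J := by
    change redInteg _ = _
    rw [redInteg_cls, integNest_functional J β.2, cls_nil_mul_cls]
    simp

end Integral

/-! ### Uniqueness of the operations -/

namespace IsReducedOperations

open Finsupp

variable {K : Type u} {F : Type v} [Field K] [CommRing F] [Algebra K F]
  [IntegroDifferentialAlgebra K F] {S : Operations K (RedSpace K F)} (hS : IsReducedOperations S)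

include hS

theorem mul_eq_redMul : S.mul = redMul :=
  redSpace_hom_ext fun f α β J => redSpace_hom_ext fun g α' β' J' =>
    (hS.mul_eq f g α α' β β' J J').trans (redMul_cls f g α α' β β' J J').symm

theorem mul_apply (x y : RedSpace K F) : S.mul x y = x * y := by
  rw [hS.mul_eq_redMul]; rfl

theorem der_eq_redDer : S.der = redDer :=
  redSpace_hom_ext fun f α β J => (hS.der_eq f α β J).trans (redDer_cls f α β J).symm

variable [CharZero K]

theorem integ_cls (f : F) (α β : MultiIndex) (J : List (Letter F)) :
    S.integ (cls K f α β J) = cls K 1 α 0 [] * S.integ (cls K f 0 β J) := by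
  rcases β.trichotomy with rfl | hf | hq
  · rw [hS.integ_quasiconstant, hS.integ_quasiconstant, mul_sub, cls_nil_mul_cls,
      cls_mul_clsIntMulDerNest]
    simp
  · rw [hS.integ_functional f α ⟨β, hf⟩, hS.integ_functional f 0 ⟨β, hf⟩, cls_nil_mul_cls]
    simp
  · obtain ⟨V, k, b, hV, rfl⟩ := hq.exists_eq
    have hb : (((b + 1 : ℕ) : K)) ≠ 0 := Nat.cast_ne_zero.2 b.succ_ne_zero
    apply smul_right_injective _ hb
    simp only
    rw [← mul_smul_comm, ← map_smul, ← map_smul, hS.integ_quasilinear f α V k b J hV,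
      hS.integ_quasilinear f 0 V k b J hV, hS.mul_apply, hS.mul_apply (cls K 1 0 0 []),
      ← one_eq_cls, one_mul, mul_sub, mul_sub, cls_nil_mul_cls, cls_mul_clsEval]
    simp

theorem integ_cls_mul (α : MultiIndex) (x : RedSpace K F) :
    S.integ (cls K 1 α 0 [] * x) = cls K 1 α 0 [] * S.integ x := by
  induction x using redSpace_induction with
  | add x y hx hy => simp only [mul_add, map_add, hx, hy]
  | smul r x hx => simp only [mul_smul_comm, map_smul, hx]
  | cls f α' β J =>
    rw [cls_nil_mul_cls, hS.integ_cls, hS.integ_cls f α', ← mul_assoc, cls_nil_mul_cls, one_mul,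
      one_mul, zero_add, zero_add]

/-- The equations for the integral say that `∫ ∘ ∂ = 1 - 𝐞`, where `𝐞` is the explicit evaluation
of reduced terms. The equation for quasilinear monomials is this identity for a monomial with
highest derivative `u_k`. -/
theorem integ_redDer (hF : IsOrdinary K F) (x : RedSpace K F) :
    S.integ (redDer x) = x - redEval x := by
  induction x using redSpace_induction with
  | add x y hx hy => simp only [map_add, hx, hy]; abel
  | smul r x hx => simp only [map_smul, hx, smul_sub]
  | cls f α β J =>
  rw [redEval_cls]
  by_cases hβ : β = 0
  · subst hβ
    have h0 : cls K (f - evaluation K f) α 0 J = cls K f α 0 J - cls K (evaluation K f) α 0 J :=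
      (clsLin K α 0 J).map_sub _ _
    have h1 : clsIntMulDerNest K (f - evaluation K f) α J
        = clsIntMulDerNest K f α J - clsIntMulDerNest K (evaluation K f) α J :=
      ((isLinearMap_clsIntMulDerNest α J).mk' _).map_sub _ _
    rw [redDer_cls, derMon_zero, add_zero, add_zero, map_add, hS.integ_quasiconstant, integ_der,
      h0, h1]
    obtain ⟨c, hc⟩ := hF.exists_evaluation_eq f
    cases J with
    | nil => simp [clsMulDerNest, clsIntMulDerNest, clsEval]
    | cons x J =>
      -- The constant `f(0)` is a scalar, so it can be moved across the integral sign.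
      have h2 : clsIntMulDerNest K (evaluation K f) α (x :: J)
          = cls K (evaluation K f) α 0 (x :: J) := by
        rw [hc, Algebra.algebraMap_eq_smul_one, (isLinearMap_cls _ _ _).map_smul,
          clsIntMulDerNest, smul_mul_assoc, one_mul,
          ((nestLinear_cls 1 α 0).head x.2 J).map_smul]
      rw [h2, clsMulDerNest, zero_add, hS.integ_functional, clsIntMulDerNest, clsEval]
      abel
  · obtain ⟨V, k, b, hV, rfl⟩ := MultiIndex.exists_eq_add_single hβ
    -- The Leibniz rule for the product of `f V J` with `u_k^(b+1)`, up to the constant `u(0)^α`.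
    have h : redDer (cls K f α (V + single k (b + 1)) J)
        = ((b + 1 : ℕ) : K) • cls K f α (V + single k b + single (k + 1) 1) J
          + cls K 1 α 0 [] * (redDer (cls K f 0 V J) * cls K 1 0 (single k (b + 1)) []) := by
      have h' : cls K f α (V + single k (b + 1)) J
          = cls K 1 α 0 [] * (cls K f 0 V J * cls K 1 0 (single k (b + 1)) []) := by
        rw [cls_mul_cls_nil, cls_nil_mul_cls]
        simp
      rw [h', redDer_cls_init, redDer_mul, mul_add, add_comm]
      congr 1
      rw [redDer_cls 1, der_one, (isLinearMap_cls _ _ _).map_zero, zero_add, derMon_single,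
        clsMulDerNest, add_zero, mul_smul_comm, mul_smul_comm, cls_mul_cls_nil, cls_nil_mul_cls]
      simp [add_assoc]
    rw [h, map_add, hS.integ_quasilinear f α V k b J hV, hS.mul_apply, hS.mul_apply,
      hS.der_eq_redDer, hS.integ_cls_mul]
    abel

/-- The derivation is surjective, so `∫ ∘ ∂ = 1 - 𝐞` determines the integral. -/
theorem eq_redOperations (hF : IsOrdinary K F) : S = redOperations K F := by
  refine Operations.ext (hS.one_eq) hS.mul_eq_redMul hS.der_eq_redDer (LinearMap.ext fun x => ?_)
  calc S.integ x = S.integ (redDer (redInteg x)) := by rw [redDer_redInteg]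
    _ = redInteg x - redEval (redInteg x) := hS.integ_redDer hF _
    _ = redInteg (redDer (redInteg x)) :=
      (isReducedOperations_redOperations.integ_redDer hF _).symm
    _ = redInteg x := by rw [redDer_redInteg]

end IsReducedOperations

/-! ### The integro-differential algebra of reduced terms -/

section RedAlgebra

variable {K : Type u} {F : Type v} [Field K] [CharZero K] [CommRing F] [Algebra K F]
  [IntegroDifferentialAlgebra K F]

theorem redInteg_redDer (hF : IsOrdinary K F) (x : RedSpace K F) :
    redInteg (redDer x) = x - redEval x :=
  isReducedOperations_redOperations.integ_redDer hF x

theorem redBaxter (hF : IsOrdinary K F) (a b : RedSpace K F) :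
    redInteg (redDer a) * redInteg (redDer b) + redInteg (redDer (a * b))
      = redInteg (redDer a) * b + a * redInteg (redDer b) := by
  simp only [redInteg_redDer hF, redEval_mul]
  ring

/-- The space of reduced terms as an integro-differential algebra. -/
@[reducible]
noncomputable def redAlgebra (hF : IsOrdinary K F) :
    IntegroDifferentialAlgebra K (RedSpace K F) where
  derivation := Derivation.mk' redDer fun a b => by
    rw [redDer_mul, smul_eq_mul, smul_eq_mul]; ring
  integral := redInteg
  der_of_integ := redDer_redInteg
  baxter := redBaxter hF

theorem isIntegroDifferential_redOperations (hF : IsOrdinary K F) :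
    (redOperations K F).IsIntegroDifferential where
  mul_assoc := redMul_assoc
  mul_comm := redMul_comm
  one_mul := redMul_one
  leibniz := redDer_mul
  der_of_integ := redDer_redInteg
  baxter := redBaxter hF

end RedAlgebra

/-! ### Homomorphisms from the integro-differential polynomials -/

namespace Poly

variable {K : Type u} {F : Type v} [CommRing K] [CommRing F] [Algebra K F]
  [IntegroDifferentialAlgebra K F] {A : Type w} [CommRing A] [Algebra K A]
  [IntegroDifferentialAlgebra K A]

/-- The value of a term in an integro-differential algebra. -/
noncomputable def termValue (ρ : F → A) (a : A) : Term K F → A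
  | .coeff f => ρ f
  | .indet => a
  | .zero => 0
  | .one => 1
  | .add s t => termValue ρ a s + termValue ρ a t
  | .neg t => -termValue ρ a t
  | .mul s t => termValue ρ a s * termValue ρ a t
  | .smul c t => c • termValue ρ a t
  | .der t => IntDiff.der K (termValue ρ a t)
  | .integ t => IntDiff.integ K (termValue ρ a t)
  | .eval t => evaluation K (termValue ρ a t)

theorem termValue_eq_of_rel (ρ : F →ₐ[K] A) (hd : ∀ f, ρ (der K f) = der K (ρ f))
    (hi : ∀ f, ρ (integ K f) = integ K (ρ f)) (a : A) {s t : Term K F} (h : Term.Rel K F s t) :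
    termValue ρ a s = termValue ρ a t := by
  induction h with
  | refl => rfl
  | symm _ ih => exact ih.symm
  | trans _ _ ih ih' => exact ih.trans ih'
  | add_assoc => exact _root_.add_assoc _ _ _
  | add_comm => exact _root_.add_comm _ _
  | zero_add => exact _root_.zero_add _
  | neg_add => exact neg_add_cancel _
  | mul_assoc => exact _root_.mul_assoc _ _ _
  | mul_comm => exact _root_.mul_comm _ _
  | one_mul => exact _root_.one_mul _
  | mul_add => exact _root_.mul_add _ _ _
  | smul_add => exact _root_.smul_add _ _ _
  | add_smul => exact _root_.add_smul _ _ _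
  | mul_smul => exact (smul_smul _ _ _).symm
  | one_smul => exact _root_.one_smul _ _
  | smul_mul => exact smul_mul_assoc _ _ _
  | der_add | integ_add | eval_add => exact map_add _ _ _
  | der_smul | integ_smul | eval_smul => exact map_smul _ _ _
  | leibniz => exact der_mul _ _
  | der_of_integ => exact der_integ _
  | eval_def => exact (evaluation_apply _).trans (sub_eq_add_neg _ _)
  | by_parts => exact mul_integ _ _
  | coeff_zero => exact map_zero ρ
  | coeff_one => exact map_one ρ
  | coeff_add => exact map_add ρ _ _
  | coeff_neg => exact map_neg ρ _
  | coeff_mul => exact map_mul ρ _ _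
  | coeff_smul => exact map_smul ρ _ _
  | coeff_der => exact hd _
  | coeff_integ => exact hi _
  | coeff_eval => simp only [termValue, evaluation_apply, map_sub, hi, hd]
  | _ => simp only [termValue, *]

/-- The homomorphism of integro-differential algebras on `F{u}` with prescribed values on the
coefficients and on the indeterminate. -/
noncomputable def lift (ρ : F →ₐ[K] A) (hd : ∀ f, ρ (der K f) = der K (ρ f))
    (hi : ∀ f, ρ (integ K f) = integ K (ρ f)) (a : A) : Poly K F →ₐ[K] A :=
  AlgHom.ofLinearMap
    { toFun := Quotient.lift (termValue ρ a) fun _ _ h => termValue_eq_of_rel ρ hd hi a h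
      map_add' := fun p q => Quotient.inductionOn₂ p q fun _ _ => rfl
      map_smul' := fun _ p => Quotient.inductionOn p fun _ => rfl }
    rfl fun p q => Quotient.inductionOn₂ p q fun _ _ => rfl

section

variable (ρ : F →ₐ[K] A) (hd : ∀ f, ρ (der K f) = der K (ρ f))
    (hi : ∀ f, ρ (integ K f) = integ K (ρ f)) (a : A)

theorem lift_der (p : Poly K F) : lift ρ hd hi a (der K p) = der K (lift ρ hd hi a p) :=
  Quotient.inductionOn p fun _ => rfl

theorem lift_integ (p : Poly K F) : lift ρ hd hi a (integ K p) = integ K (lift ρ hd hi a p) :=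
  Quotient.inductionOn p fun _ => rfl

end

/-- Endomorphisms of `F{u}` that fix the coefficients and the indeterminate are trivial. -/
theorem hom_eq_id {T : Poly K F →ₗ[K] Poly K F} (hone : T 1 = 1)
    (hmul : ∀ p q, T (p * q) = T p * T q) (hd : ∀ p, T (der K p) = der K (T p))
    (hi : ∀ p, T (integ K p) = integ K (T p)) (hc : ∀ f, T (coeff f) = coeff f)
    (hu : T indet = indet) (p : Poly K F) : T p = p := by
  induction p using Quotient.inductionOn with
  | _ t =>
  change T (mk t) = mk t
  induction t with
  | coeff f => exact hc f
  | indet => exact hu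
  | zero => exact map_zero T
  | one => exact hone
  | add s t hs ht => exact (map_add T (mk s) (mk t)).trans (by rw [hs, ht]; rfl)
  | neg t ht => exact (map_neg T (mk t)).trans (by rw [ht]; rfl)
  | mul s t hs ht => exact (hmul (mk s) (mk t)).trans (by rw [hs, ht]; rfl)
  | smul c t ht => exact (map_smul T c (mk t)).trans (by rw [ht]; rfl)
  | der t ht => exact (hd (mk t)).trans (by rw [ht]; rfl)
  | integ t ht => exact (hi (mk t)).trans (by rw [ht]; rfl)
  | eval t ht =>
    have h : (mk (.eval t) : Poly K F) = mk t - integ K (der K (mk t)) :=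
      (sound (.eval_def t)).trans 
        (sub_eq_add_neg (mk t : Poly K F) (integ K (der K (mk t)))).symm
    rw [h, map_sub, hi, hd, ht]

end Poly

/-! ### Polynomials represented by reduced terms -/

namespace Poly

open Finsupp

variable {K : Type u} {F : Type v} [CommRing K] [CommRing F] [Algebra K F]
  [IntegroDifferentialAlgebra K F]

variable (K F) in
/-- The inclusion of the coefficients as a homomorphism of algebras. -/
noncomputable def coeffHom : F →ₐ[K] Poly K F :=
  AlgHom.ofLinearMap
    { toFun := coeff
      map_add' := fun f g => sound (.coeff_add f g)
      map_smul' := fun c f => sound (.coeff_smul c f) }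
    (sound .coeff_one) fun f g => sound (.coeff_mul f g)

theorem coeff_one : (coeff 1 : Poly K F) = 1 := sound .coeff_one

theorem coeff_mul (f g : F) : (coeff (f * g) : Poly K F) = coeff f * coeff g :=
  sound (.coeff_mul f g)

theorem der_coeff (f : F) : der K (coeff f : Poly K F) = coeff (der K f) :=
  (sound (.coeff_der f)).symm

theorem evaluation_coeff (f : F) : evaluation K (coeff f : Poly K F) = coeff (evaluation K f) := by
  have h : integ K (coeff (der K f) : Poly K F) = coeff (integ K (der K f)) :=
    (sound (.coeff_integ _)).symm
  rw [evaluation_apply, evaluation_apply, der_coeff, h]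
  exact (map_sub (coeffHom K F) _ _).symm

theorem diffMon_zero : diffMon 0 = (1 : Poly K F) := Finsupp.prod_zero_index

theorem diffMon_add (β β' : MultiIndex) :
    (diffMon (β + β') : Poly K F) = diffMon β * diffMon β' :=
  Finsupp.prod_add_index' (fun _ => pow_zero _) fun _ _ _ => pow_add _ _ _

theorem diffMon_single (i n : ℕ) : (diffMon (single i n) : Poly K F) = uder i ^ n :=
  Finsupp.prod_single_index (pow_zero _)

theorem initMon_eq_evaluation (α : MultiIndex) :
    (initMon α : Poly K F) = evaluation K (diffMon α) := by
  let ev : Poly K F →+* Poly K F :=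
    { (evaluation K : Poly K F →ₗ[K] Poly K F).toAddMonoidHom with
      map_one' := evaluation_one
      map_mul' := evaluation_mul }
  change _ = ev (diffMon α)
  rw [diffMon, map_finsuppProd]
  simp only [map_pow]
  rfl

theorem initMon_zero : initMon 0 = (1 : Poly K F) := Finsupp.prod_zero_index

theorem initMon_add (α α' : MultiIndex) :
    (initMon (α + α') : Poly K F) = initMon α * initMon α' :=
  Finsupp.prod_add_index' (fun _ => pow_zero _) fun _ _ _ => pow_add _ _ _

theorem der_uder (i : ℕ) : der K (uder i : Poly K F) = uder (i + 1) :=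
  (Function.iterate_succ_apply' _ _ _).symm

theorem der_diffMon (β : MultiIndex) :
    der K (diffMon β : Poly K F) = derMon K (fun W => diffMon W) β := by
  induction β using Finsupp.induction_linear with
  | zero => rw [diffMon_zero, der_one, derMon_zero]
  | add β β' h h' =>
    rw [diffMon_add, der_mul, h, h', derMon_add]
    simp only [diffMon_add]
    exact congrArg₂ (· + ·) (map_derMon (LinearMap.mulRight K (diffMon β')) _ _)
      (map_derMon (LinearMap.mulLeft K (diffMon β)) _ _)
  | single k n =>
    rw [derMon_single, diffMon_add, diffMon_single, diffMon_single, diffMon_single, pow_one,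
      ← der_uder]
    refine ((IntegroDifferentialAlgebra.derivation (K := K) (A := Poly K F)).leibniz_pow
      (uder k) n).trans ?_
    rw [smul_eq_mul, Nat.cast_smul_eq_nsmul]
    rfl

theorem nested_cons (x : Letter F) (J : List (Letter F)) :
    (nested (x :: J) : Poly K F) = integ K (coeff x.1 * diffMon x.2.1 * nested J) := rfl

theorem nestLinear_nested : NestLinear K (nested : List (Letter F) → Poly K F) := by
  intro P γ Q
  induction P with
  | nil =>
    exact (integ K ∘ₗ LinearMap.mulRight K (nested Q) ∘ₗ LinearMap.mulRight K (diffMon γ.1) ∘ₗ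
      (coeffHom K F).toLinearMap).isLinear
  | cons x P ih =>
    exact isLinearMap_apply (integ K ∘ₗ LinearMap.mulLeft K (coeff x.1 * diffMon x.2.1)) ih

/-- Nested integrals multiply by shuffling, as a consequence of the Rota--Baxter identity. -/
theorem nested_mul_nested (J J' : List (Letter F)) :
    (nested J * nested J' : Poly K F) = shuffleSum nested J J' := by
  induction J generalizing J' with
  | nil => rw [shuffleSum_nil_left, nested, one_mul]
  | cons x J ih =>
    induction J' with
    | nil => rw [shuffleSum_nil_right, nested, mul_one]
    | cons y J' ih' =>
      have hs (z : Letter F) (L L' : List (Letter F)) :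
          (integ K (coeff z.1 * diffMon z.2.1 * shuffleSum nested L L') : Poly K F)
            = shuffleSum (fun J => nested (z :: J)) L L' :=
        map_shuffleSum (integ K ∘ₗ LinearMap.mulLeft K (coeff z.1 * diffMon z.2.1 : Poly K F))
          nested L L'
      rw [nested_cons, nested_cons, integ_mul_integ, ← nested_cons, ← nested_cons,
        mul_assoc _ (nested J), ih, mul_assoc _ (nested J'), mul_comm (nested J'), ih',
        shuffleSum_cons_cons, hs, hs]

end Poly

section Represent

open IntDiff.Poly

variable {K : Type u} {F : Type v} [CommRing K] [CommRing F] [Algebra K F]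
  [IntegroDifferentialAlgebra K F]

variable (K F) in
/-- The linear map sending the class of a reduced term to the polynomial it represents. -/
noncomputable def represent : RedSpace K F →ₗ[K] Poly K F :=
  liftRed (fun f α β J => ofRedTerm ⟨f, α, β, J⟩)
    (fun α β J => (LinearMap.mulRight K (nested J) ∘ₗ LinearMap.mulRight K (diffMon β) ∘ₗ
      LinearMap.mulRight K (initMon α) ∘ₗ (coeffHom K F).toLinearMap).isLinear)
    (fun f α β => nestLinear_nested.apply
      (LinearMap.mulLeft K (coeff f * initMon α * diffMon β)))

theorem represent_cls (f : F) (α β : MultiIndex) (J : List (Letter F)) :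
    represent K F (cls K f α β J) = coeff f * initMon α * diffMon β * nested J :=
  liftRed_cls _ _ _ _ _ _ _

theorem represent_one : represent K F 1 = 1 := by
  rw [one_eq_cls, represent_cls, coeff_one, initMon_zero, diffMon_zero, nested]
  simp

theorem represent_mul (x y : RedSpace K F) :
    represent K F (x * y) = represent K F x * represent K F y := by
  induction x using redSpace_induction with
  | add x y hx hy => simp only [add_mul, map_add, hx, hy]
  | smul r x hx => simp only [smul_mul_assoc, map_smul, hx]
  | cls f α β J =>
  induction y using redSpace_induction with
  | add x y hx hy => simp only [mul_add, map_add, hx, hy]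
  | smul r x hx => simp only [mul_smul_comm, map_smul, hx]
  | cls g α' β' J' =>
  rw [cls_mul_cls, map_shuffleSum]
  simp only [represent_cls]
  have h := map_shuffleSum (LinearMap.mulLeft K (coeff (f * g) * initMon (α + α') *
    diffMon (β + β') : Poly K F)) nested J J'
  simp only [LinearMap.mulLeft_apply] at h
  rw [← h, ← nested_mul_nested, coeff_mul, initMon_add, diffMon_add]
  ring

theorem represent_der (x : RedSpace K F) :
    represent K F (redDer x) = der K (represent K F x) := by
  induction x using redSpace_induction with
  | add x y hx hy => simp only [map_add, hx, hy]
  | smul r x hx => simp only [map_smul, hx]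
  | cls f α β J =>
  have h1 : represent K F (derMon K (fun W => cls K f α W J) β)
      = coeff f * initMon α * der K (diffMon β) * nested J := by
    rw [map_derMon, der_diffMon]
    simp only [represent_cls]
    exact (map_derMon (LinearMap.mulRight K (nested J) ∘ₗ
      LinearMap.mulLeft K (coeff f * initMon α)) _ _).symm
  have h2 : represent K F (clsMulDerNest K f α β J)
      = coeff f * initMon α * diffMon β * der K (nested J) := by
    cases J with
    | nil => rw [clsMulDerNest, map_zero, nested, der_one, mul_zero]
    | cons x J =>
      rw [clsMulDerNest, represent_cls, nested_cons, der_integ, coeff_mul, diffMon_add]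
      ring
  rw [redDer_cls, map_add, map_add, h1, h2, represent_cls, represent_cls, der_mul, der_mul,
    der_mul, der_coeff, initMon_eq_evaluation, der_evaluation]
  ring

theorem represent_eval (x : RedSpace K F) :
    represent K F (redEval x) = evaluation K (represent K F x) := by
  induction x using redSpace_induction with
  | add x y hx hy => simp only [map_add, hx, hy]
  | smul r x hx => simp only [map_smul, hx]
  | cls f α β J =>
  rw [redEval_cls, represent_cls, evaluation_mul, evaluation_mul, evaluation_mul, evaluation_coeff,
    initMon_eq_evaluation, evaluation_evaluation]
  cases J with
  | nil =>
    rw [clsEval, represent_cls, initMon_add, initMon_eq_evaluation, initMon_eq_evaluation,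
      diffMon_zero, nested, evaluation_one]
    ring
  | cons x J => rw [clsEval, map_zero, nested_cons, evaluation_integ, mul_zero]

end Represent

/-! ### The isomorphism -/

section Isomorphism

open IntDiff.Poly Finsupp

variable {K : Type u} {F : Type v} [Field K] [CharZero K] [CommRing F] [Algebra K F]
  [IntegroDifferentialAlgebra K F]

theorem represent_integ (hF : IsOrdinary K F) (x : RedSpace K F) :
    represent K F (redInteg x) = integ K (represent K F x) := by
  refine eq_of_der_of_evaluation (K := K) ?_ ?_
  · rw [← represent_der, redDer_redInteg, der_integ]
  · have h := redInteg_redDer hF (redInteg x)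
    rw [redDer_redInteg] at h
    rw [evaluation_integ, ← represent_eval, sub_eq_self.1 h.symm, map_zero]

/-- The reduction of polynomials to classes of reduced terms. -/
theorem exists_reduction (hF : IsOrdinary K F) : ∃ ψ : Poly K F →ₐ[K] RedSpace K F,
    (∀ f, ψ (coeff f) = cls K f 0 0 []) ∧ ψ indet = cls K 1 0 (single 0 1) [] ∧
    (∀ p, ψ (der K p) = redDer (ψ p)) ∧ ∀ p, ψ (integ K p) = redInteg (ψ p) := by
  let _ := redAlgebra hF
  let ρ : F →ₐ[K] RedSpace K F := AlgHom.ofLinearMap (clsLin K 0 0 []) rfl fun f g =>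
    (cls_nil_mul_cls f g 0 0 0 0 []).symm
  have hd (f : F) : ρ (der K f) = der K (ρ f) := by
    refine Eq.symm ((redDer_cls f 0 0 []).trans ?_)
    rw [derMon_zero, clsMulDerNest, add_zero, add_zero]
    rfl
  have hi (f : F) : ρ (integ K f) = integ K (ρ f) := by
    refine Eq.symm ((redInteg_cls_zero f 0 []).trans ?_)
    rw [integNest_zero, clsIntMulDerNest, sub_zero]
    rfl
  exact ⟨lift ρ hd hi (cls K 1 0 (single 0 1) []), fun _ => rfl, rfl, lift_der ρ hd hi _,
    lift_integ ρ hd hi _⟩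

theorem reduction_represent (hF : IsOrdinary K F) {ψ : Poly K F →ₐ[K] RedSpace K F}
    (hc : ∀ f, ψ (coeff f) = cls K f 0 0 []) (hu : ψ indet = cls K 1 0 (single 0 1) [])
    (hd : ∀ p, ψ (der K p) = redDer (ψ p)) (hi : ∀ p, ψ (integ K p) = redInteg (ψ p))
    (x : RedSpace K F) : ψ (represent K F x) = x := by
  have hev (p : Poly K F) : ψ (evaluation K p) = redEval (ψ p) := by
    rw [evaluation_apply, map_sub, hi, hd, redInteg_redDer hF, sub_sub_cancel]
  have huder (i : ℕ) : ψ (uder i) = cls K 1 0 (single i 1) [] := by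
    induction i with
    | zero => exact hu
    | succ i ih =>
      rw [← der_uder, hd, ih, redDer_cls, der_one, (isLinearMap_cls _ _ _).map_zero, derMon_single]
      simp [clsMulDerNest]
  have hmon (β : MultiIndex) : ψ (diffMon β) = cls K 1 0 β [] := by
    induction β using Finsupp.induction_linear with
    | zero => rw [diffMon_zero, map_one, one_eq_cls]
    | add β β' h h' => rw [diffMon_add, map_mul, h, h', cls_nil_mul_cls, one_mul, add_zero]
    | single i n =>
      rw [diffMon_single]
      induction n with
      | zero => rw [pow_zero, map_one, single_zero, one_eq_cls]
      | succ n ih =>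
        rw [pow_succ, map_mul, ih, huder, cls_nil_mul_cls, one_mul, add_zero, single_add]
  have hinit (α : MultiIndex) : ψ (initMon α) = cls K 1 α 0 [] := by
    rw [initMon_eq_evaluation, hev, hmon, redEval_cls, evaluation_one, zero_add, clsEval]
  have hnest (J : List (Letter F)) : ψ (nested J) = cls K 1 0 0 J := by
    induction J with
    | nil => exact map_one ψ
    | cons x J ih =>
      rw [nested_cons, hi, map_mul ψ, map_mul ψ, hc, hmon, ih, cls_nil_mul_cls, cls_nil_mul_cls,
        mul_one, mul_one, add_zero, add_zero, zero_add, add_zero, redInteg_cls_zero,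
        integNest_functional J x.2.2]
  suffices h : ψ.toLinearMap ∘ₗ represent K F = LinearMap.id from DFunLike.congr_fun h x
  refine redSpace_hom_ext fun f α β J => ?_
  change ψ (represent K F (cls K f α β J)) = cls K f α β J
  rw [represent_cls, map_mul, map_mul, map_mul, hc, hmon, hinit, hnest]
  simp [cls_nil_mul_cls]

theorem bijective_represent (hF : IsOrdinary K F) : Function.Bijective (represent K F) := by
  obtain ⟨ψ, hc, hu, hd, hi⟩ := exists_reduction hF
  refine ⟨Function.LeftInverse.injective (reduction_represent hF hc hu hd hi),
    fun p => ⟨ψ p, ?_⟩⟩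
  refine hom_eq_id (T := represent K F ∘ₗ ψ.toLinearMap) ?_ ?_ ?_ ?_ ?_ ?_ p
  · exact (congrArg _ (map_one ψ)).trans represent_one
  · exact fun p q => (congrArg _ (map_mul ψ p q)).trans (represent_mul _ _)
  · exact fun p => (congrArg _ (hd p)).trans (represent_der _)
  · exact fun p => (congrArg _ (hi p)).trans (represent_integ hF _)
  · intro f
    change represent K F (ψ (coeff f)) = _
    rw [hc, represent_cls, initMon_zero, diffMon_zero, nested]
    simp
  · change represent K F (ψ indet) = _
    rw [hu, represent_cls, initMon_zero, diffMon_single, nested, coeff_one, pow_one]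
    simp [uder]

end Isomorphism

/-! ### Canonical forms -/

section Basis

variable {K : Type u} {F : Type v} [CommRing K] [CommRing F] [Algebra K F] {ι : Type w}
  (b : Module.Basis ι K F)

/-- The expansion of a nested integral with respect to a basis of the coefficient algebra. -/
noncomputable def nestCoord : List (Letter F) → (List (Letter ι) →₀ K)
  | [] => Finsupp.single [] 1
  | (g, γ) :: J =>
    b.constr K (fun i => Finsupp.lmapDomain K K (List.cons ((i, γ) : Letter ι))) g (nestCoord J)

theorem nestLinear_nestCoord : NestLinear K (nestCoord b) := by
  intro P γ Q
  induction P with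
  | nil =>
    exact ((b.constr K fun i =>
      Finsupp.lmapDomain K K (List.cons ((i, γ) : Letter ι))).flip (nestCoord b Q)).isLinear
  | cons x P ih => exact isLinearMap_apply _ ih

theorem nestCoord_map (L : List (Letter ι)) :
    nestCoord b (L.map fun p => (b p.1, p.2)) = Finsupp.single L 1 := by
  induction L with
  | nil => rfl
  | cons x L ih => simp [nestCoord, ih, Module.Basis.constr_basis]

/-- A nest-linear function is determined by its values on words with basis coefficients. -/
theorem linearCombination_nestCoord {M : Type w'} [AddCommGroup M] [Module K M]
    {Φ : List (Letter F) → M} (h : NestLinear K Φ) (J : List (Letter F)) :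
    Finsupp.linearCombination K (fun L : List (Letter ι) => Φ (L.map fun p => (b p.1, p.2)))
      (nestCoord b J) = Φ J := by
  induction J generalizing Φ with
  | nil => simp [nestCoord]
  | cons x J ih =>
    obtain ⟨g, γ⟩ := x
    refine DFunLike.congr_fun (f := Finsupp.linearCombination K
      (fun L : List (Letter ι) => Φ (L.map fun p => (b p.1, p.2))) ∘ₗ (b.constr K fun i =>
        Finsupp.lmapDomain K K (List.cons ((i, γ) : Letter ι))).flip (nestCoord b J))
      (g := (h.head γ J).mk' _) (b.ext fun i => ?_) g
    simp only [LinearMap.comp_apply, LinearMap.flip_apply, Module.Basis.constr_basis,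
      Finsupp.lmapDomain_apply, Finsupp.linearCombination_mapDomain]
    exact ih (h.tail (b i, γ))

/-- The expansion of reduced terms with respect to a basis of the coefficient algebra. -/
noncomputable def redCoord : RedSpace K F →ₗ[K] (RedTerm ι →₀ K) :=
  liftRed (fun f α β J => b.constr K (fun i => Finsupp.lmapDomain K K
      fun L : List (Letter ι) => (⟨i, α, β, L⟩ : RedTerm ι)) f (nestCoord b J))
    (fun α β J => ((b.constr K (fun i => Finsupp.lmapDomain K K
      fun L : List (Letter ι) => (⟨i, α, β, L⟩ : RedTerm ι))).flip (nestCoord b J)).isLinear)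
    (fun _ _ _ => (nestLinear_nestCoord b).apply _)

variable (K) in
/-- The class of a reduced term. -/
noncomputable def termCls (t : RedTerm F) : RedSpace K F := cls K t.coeff t.init t.mon t.nest

theorem redCoord_cls (f : F) (α β : MultiIndex) (J : List (Letter F)) :
    redCoord b (cls K f α β J) = b.constr K (fun i => Finsupp.lmapDomain K K
      fun L : List (Letter ι) => (⟨i, α, β, L⟩ : RedTerm ι)) f (nestCoord b J) :=
  liftRed_cls _ _ _ _ _ _ _

theorem redCoord_termCls (t : RedTerm ι) :
    redCoord b (termCls K (t.map b)) = Finsupp.single t 1 := by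
  rw [termCls, redCoord_cls, RedTerm.map, nestCoord_map, Module.Basis.constr_basis]
  simp

/-- The classes of the reduced terms with basis coefficients form a basis. -/
theorem bijective_linearCombination_termCls :
    Function.Bijective (Finsupp.linearCombination K fun t : RedTerm ι => termCls K (t.map b)) := by
  refine Function.bijective_iff_has_inverse.2 ⟨redCoord b, fun c => ?_, fun x => ?_⟩
  · suffices h : redCoord b ∘ₗ (Finsupp.linearCombination K fun t => termCls K (t.map b))
        = LinearMap.id from DFunLike.congr_fun h c
    refine Finsupp.lhom_ext' fun t => LinearMap.ext_ring ?_
    simp [redCoord_termCls]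
  · suffices h : (Finsupp.linearCombination K fun t => termCls K (t.map b)) ∘ₗ redCoord b
        = LinearMap.id from DFunLike.congr_fun h x
    refine redSpace_hom_ext fun f α β J => ?_
    rw [LinearMap.comp_apply, redCoord_cls]
    refine DFunLike.congr_fun (f := Finsupp.linearCombination K
      (fun t : RedTerm ι => termCls K (t.map b)) ∘ₗ (b.constr K fun i => Finsupp.lmapDomain K K
        fun L : List (Letter ι) => (⟨i, α, β, L⟩ : RedTerm ι)).flip (nestCoord b J))
      (g := clsLin K α β J) (b.ext fun i => ?_) f
    simp only [LinearMap.comp_apply, LinearMap.flip_apply, Module.Basis.constr_basis,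
      Finsupp.lmapDomain_apply, Finsupp.linearCombination_mapDomain]
    exact linearCombination_nestCoord b (nestLinear_cls (b i) α β) J

end Basis

end IntDiff

theorem mainTheorem2 {K : Type*} {F : Type*} [Field K] [CharZero K] [CommRing F] [Algebra K F]
    [IntegroDifferentialAlgebra K F] (hF : IsOrdinary K F) :
    -- the defining equations determine unique, well-defined operations on the quotient space
    (∃! S : Operations K (RedSpace K F), IsReducedOperations S) ∧
    (∀ S : Operations K (RedSpace K F), IsReducedOperations S →
      -- with which it is an integro-differential algebra
      S.IsIntegroDifferential ∧
      -- isomorphic to the integro-differential polynomials via "term represents polynomial"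
      ∃ φ : RedSpace K F ≃ₗ[K] Poly K F,
        (∀ t : RedTerm F, φ (cls K t.coeff t.init t.mon t.nest) = Poly.ofRedTerm t) ∧
        φ S.one = 1 ∧
        (∀ x y, φ (S.mul x y) = φ x * φ y) ∧
        (∀ x, φ (S.der x) = der K (φ x)) ∧
        (∀ x, φ (S.integ x) = integ K (φ x))) ∧
    -- canonical forms after the choice of a basis of the coefficient algebra
    (∀ {ι : Type*} (b : Module.Basis ι K F) (p : Poly K F),
      ∃! c : RedTerm ι →₀ K,
        Finsupp.linearCombination K (fun t => (Poly.ofRedTerm (t.map b) : Poly K F)) c = p) := by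
  refine ⟨⟨redOperations K F, isReducedOperations_redOperations,
    fun S hS => hS.eq_redOperations hF⟩, fun S hS => ?_, fun {ι} b p => ?_⟩
  · obtain rfl := hS.eq_redOperations hF
    exact ⟨isIntegroDifferential_redOperations hF,
      LinearEquiv.ofBijective (represent K F) (bijective_represent hF),
      fun t => represent_cls _ _ _ _, represent_one, represent_mul, represent_der,
      represent_integ hF⟩
  · have h : Finsupp.linearCombination K (fun t => (Poly.ofRedTerm (t.map b) : Poly K F))
        = represent K F ∘ₗ Finsupp.linearCombination K fun t : RedTerm ι => termCls K (t.map b) :=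
      Finsupp.lhom_ext' fun t => LinearMap.ext_ring (by simp [termCls, represent_cls, Poly.ofRedTerm])
    rw [h]
    exact ((bijective_represent hF).comp (bijective_linearCombination_termCls b)).existsUnique p
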